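/- Let $d,d'\ge 1$, $T>0$, and $\mathcal O=[0,T]\times\mathbb R^d$. Let $\mathcal D\subseteq\mathcal O$ be closed and put $\mathcal C=\mathcal O\setminus\mathcal D$ and $\mathcal C_{[0,T)}=\mathcal C\cap([0,T)\times\mathbb R^d)$. Let $\mu:\mathcal O\to\mathbb R^d$ and $\sigma:\mathcal O\to\mathbb R^{d\times d'}$ be measurable, locally Lipschitz in $x$ and of linear growth in $x$, uniformly for $t\in[0,T]$. Let $W=(W_s)_{s\in[0,T]}$ be a $d'$-dimensional Brownian motion on a probability space $(\Omega,\mathcal F,\mathsf P)$ and let $(\mathcal F_s)_{s\in[0,T]}$ be its natural filtration augmented with the $\mathsf P$-null sets. Let $\alpha:\mathcal C_{[0,T)}\to\mathbb R^{d'}$ be measurable, locally bounded, and locally Lipschitz in the spatial variable; that is, every point of $\mathcal C_{[0,T)}$ has a neighbourhood $U$ in $\mathcal C_{[0,T)}$ on which $\alpha$ is bounded and for which there is a constant $L$ with $|\alpha(s,y)-\alpha(s,z)|\le L|y-z|$ for all $(s,y),(s,z)\in U$. Then, for every $(t,x)\in\mathcal C$, there is at most one strong solution (that is, a continuous process adapted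 to $(\mathcal F_s)$, unique up to indistinguishability) of $$X_s=x+\int_t^s\big[\mu(u,X_u)+\sigma(u,X_u)\alpha(u,X_u)\big]\,\mathrm du+\int_t^s\sigma(u,X_u)\,\mathrm dW_u,\qquad s\in[t,T],$$ such that $\mathsf P\big((s,X_s)\in\mathcal C\ \text{for all } s\in[t,T]\big)=1$. In other words, if $X$ and $X'$ are two such solutions, then $\mathsf P(X_s=X'_s\ \text{for all } s\in[t,T])=1$. -/

import Mathlib

open MeasureTheory ProbabilityTheory Filter Topology

noncomputable section

namespace ConstrainedSDE

/-- The Euclidean state space `ℝ^d`. -/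
abbrev Space (d : ℕ) : Type := EuclideanSpace ℝ (Fin d)

/-- The time-space domain `𝒪 = [0,T] × ℝ^d`. -/
def timeSpace (d : ℕ) (T : ℝ) : Set (ℝ × Space d) := {p | 0 ≤ p.1 ∧ p.1 ≤ T}

/-- The allowed region `𝒞 = 𝒪 \ 𝒟`. -/
def allowed {d : ℕ} (T : ℝ) (D : Set (ℝ × Space d)) : Set (ℝ × Space d) := timeSpace d T \ D

/-- The part `𝒞_{[0,T)}` of the allowed region strictly before the terminal time. -/
def allowedBefore {d : ℕ} (T : ℝ) (D : Set (ℝ × Space d)) : Set (ℝ × Space d) :=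
  {p | p ∈ allowed T D ∧ p.1 < T}

/-- The Euclidean norm `(∑ᵢⱼ |Aᵢⱼ|²)^{1/2}` of a matrix. -/
def matNorm {d d' : ℕ} (A : Matrix (Fin d) (Fin d') ℝ) : ℝ := √(∑ i, ∑ j, A i j ^ 2)

/-- Standing conditions on the coefficients `μ : 𝒪 → ℝ^d` and `σ : 𝒪 → ℝ^{d×d'}`: measurable,
locally Lipschitz in `x` and of linear growth in `x`, uniformly in `t ∈ [0,T]`.
Only the values on `𝒪` are constrained. -/
structure IsCoefficientPair {d d' : ℕ} (T : ℝ) (μ : ℝ × Space d → Space d)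
    (σ : ℝ × Space d → Matrix (Fin d) (Fin d') ℝ) : Prop where
  measurable_drift : Measurable ((timeSpace d T).domRestrict μ)
  measurable_diffusion : ∀ i j, Measurable ((timeSpace d T).domRestrict fun p => σ p i j)
  locallyLipschitz : ∀ R : ℝ, ∃ L : ℝ, ∀ s : ℝ, 0 ≤ s → s ≤ T → ∀ x y : Space d,
    ‖x‖ ≤ R → ‖y‖ ≤ R →
      ‖μ (s, x) - μ (s, y)‖ ≤ L * ‖x - y‖ ∧ matNorm (σ (s, x) - σ (s, y)) ≤ L * ‖x - y‖
  linearGrowth : ∃ K : ℝ, ∀ s : ℝ, 0 ≤ s → s ≤ T → ∀ x : Space d,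
    ‖μ (s, x)‖ ≤ K * (1 + ‖x‖) ∧ matNorm (σ (s, x)) ≤ K * (1 + ‖x‖)

/-- `a` is locally Lipschitz in the spatial variable on `A ⊆ ℝ × ℝ^d`: every point of `A` has a
neighbourhood in `A` on which `a (s, ·)` is Lipschitz with a constant that does not depend on
`s`. -/
def LocallyLipschitzInSpaceOn {d d' : ℕ} (a : ℝ × Space d → Space d')
    (A : Set (ℝ × Space d)) : Prop :=
  ∀ p ∈ A, ∃ U ∈ 𝓝[A] p, ∃ L : ℝ, ∀ (s : ℝ) (x y : Space d), (s, x) ∈ U → (s, y) ∈ U →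
    ‖a (s, x) - a (s, y)‖ ≤ L * ‖x - y‖

/-- `a` is locally bounded on `A`: every point of `A` has a neighbourhood in `A` on which `a` is
bounded. -/
def LocallyBoundedOn {d d' : ℕ} (a : ℝ × Space d → Space d') (A : Set (ℝ × Space d)) : Prop :=
  ∀ p ∈ A, ∃ U ∈ 𝓝[A] p, ∃ M : ℝ, ∀ q ∈ U, ‖a q‖ ≤ M

section Probability

variable {Ω : Type*} [MeasurableSpace Ω]

/-- `W` is a standard `d'`-dimensional Brownian motion on the time interval `[0,T]`. -/
structure IsBrownianMotionOn {d' : ℕ} (T : ℝ) (W : ℝ → Ω → Fin d' → ℝ) (P : Measure Ω) :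
    Prop where
  measurable : ∀ s ∈ Set.Icc 0 T, Measurable (W s)
  zero : ∀ᵐ ω ∂P, W 0 ω = 0
  hasLaw_increment : ∀ s u : ℝ, 0 ≤ s → s ≤ u → u ≤ T →
    HasLaw (W u - W s) (Measure.pi fun _ => gaussianReal 0 (u - s).toNNReal) P
  indep_increment : ∀ s u : ℝ, 0 ≤ s → s ≤ u → u ≤ T →
    IndepFun (W u - W s) (fun ω (r : Set.Icc 0 s) => W r ω) P
  continuous : ∀ᵐ ω ∂P, ContinuousOn (fun s => W s ω) (Set.Icc 0 T)

/-- The Brownian filtration augmented with the null sets: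
`𝓕_s = σ(W_r, 0 ≤ r ≤ s) ∨ {P-null sets}`. -/
@[reducible]
def brownianFiltration {d' : ℕ} (P : Measure Ω) (W : ℝ → Ω → Fin d' → ℝ) (s : ℝ) :
    MeasurableSpace Ω :=
  (⨆ r ∈ Set.Icc 0 s, MeasurableSpace.comap (W r) inferInstance) ⊔
    MeasurableSpace.generateFrom {A | MeasurableSet A ∧ P A = 0}

/-- An elementary integrand `∑_{k<n} ξ_k 1_{(τ_k, τ_{k+1}]}` on `[t,T]`, with deterministic times
`τ_k` and bounded `𝓕_{τ_k}`-measurable heights `ξ_k`. -/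
structure ElementaryProcess (F : ℝ → MeasurableSpace Ω) (t T : ℝ) where
  /-- number of steps -/
  n : ℕ
  /-- partition times -/
  τ : ℕ → ℝ
  /-- heights -/
  ξ : ℕ → Ω → ℝ
  monotone_time : Monotone τ
  time_mem : ∀ k, τ k ∈ Set.Icc t T
  measurable_height : ∀ k, Measurable[F (τ k)] (ξ k)
  bounded_height : ∀ k, ∃ c : ℝ, ∀ ω, |ξ k ω| ≤ c

namespace ElementaryProcess

variable {F : ℝ → MeasurableSpace Ω} {t T : ℝ}

/-- The value of the elementary integrand at time `u`. -/
def value (G : ElementaryProcess F t T) (u : ℝ) (ω : Ω) : ℝ :=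
  ∑ k ∈ Finset.range G.n, (Set.Ioc (G.τ k) (G.τ (k + 1))).indicator (fun _ => G.ξ k ω) u

/-- The elementary stochastic integral `∑_{k<n} ξ_k (B_{τ_{k+1} ∧ s} - B_{τ_k ∧ s})`. -/
def integral (G : ElementaryProcess F t T) (B : ℝ → Ω → ℝ) (s : ℝ) (ω : Ω) : ℝ :=
  ∑ k ∈ Finset.range G.n, G.ξ k ω * (B (min (G.τ (k + 1)) s) ω - B (min (G.τ k) s) ω)

end ElementaryProcess

/-- `I` is (a version with continuous paths of) the Itô integral `I_s = ∫_t^s H_u dB_u`,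
`s ∈ [t,T]`, of an integrand `H` with `∫_t^T H_u² du < ∞` almost surely: it is the limit in
probability of the elementary integrals of elementary integrands `Gₙ` such that
`∫_t^T (Gₙ - H)² du → 0` in probability. -/
structure IsItoIntegral (P : Measure Ω) (F : ℝ → MeasurableSpace Ω) (t T : ℝ)
    (B H I : ℝ → Ω → ℝ) : Prop where
  memLp : ∀ᵐ ω ∂P, MemLp (fun u => H u ω) 2 (volume.restrict (Set.Icc t T))
  adapted : ∀ s ∈ Set.Icc t T, Measurable[F s] (I s)
  continuous : ∀ᵐ ω ∂P, ContinuousOn (fun s => I s ω) (Set.Icc t T)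
  approx : ∃ G : ℕ → ElementaryProcess F t T,
    TendstoInMeasure P (fun n ω => ∫ u in Set.Icc t T, ((G n).value u ω - H u ω) ^ 2) atTop
      (fun _ => 0) ∧
    ∀ s ∈ Set.Icc t T, TendstoInMeasure P (fun n => (G n).integral B s) atTop (I s)

/-- The drift `μ + σ α`. -/
def controlledDrift {d d' : ℕ} (μ : ℝ × Space d → Space d)
    (σ : ℝ × Space d → Matrix (Fin d) (Fin d') ℝ) (α : ℝ × Space d → Space d')
    (p : ℝ × Space d) : Space d :=
  μ p + WithLp.toLp 2 ((σ p).mulVec (α p).ofLp)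

/-- `X` is a strong solution on `[t,T]` (continuous and adapted to the augmented Brownian
filtration) of
`X_s = x + ∫_t^s [μ(u,X_u) + σ(u,X_u) α(u,X_u)] du + ∫_t^s σ(u,X_u) dW_u`. -/
structure IsStrongSolution {d d' : ℕ} (P : Measure Ω) (W : ℝ → Ω → Fin d' → ℝ) (T : ℝ)
    (μ : ℝ × Space d → Space d) (σ : ℝ × Space d → Matrix (Fin d) (Fin d') ℝ)
    (α : ℝ × Space d → Space d') (t : ℝ) (x : Space d) (X : ℝ → Ω → Space d) : Prop where
  adapted : ∀ s ∈ Set.Icc t T, Measurable[brownianFiltration P W s] (X s)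
  continuous : ∀ᵐ ω ∂P, ContinuousOn (fun s => X s ω) (Set.Icc t T)
  integrable_drift : ∀ᵐ ω ∂P,
    IntegrableOn (fun u => controlledDrift μ σ α (u, X u ω)) (Set.Icc t T)
  equation : ∃ I : Fin d → Fin d' → ℝ → Ω → ℝ,
    (∀ i j, IsItoIntegral P (brownianFiltration P W) t T (fun s ω => W s ω j)
      (fun u ω => σ (u, X u ω) i j) (I i j)) ∧
    ∀ᵐ ω ∂P, ∀ s ∈ Set.Icc t T, ∀ i : Fin d,
      X s ω i = x i + (∫ u in t..s, controlledDrift μ σ α (u, X u ω)) i + ∑ j, I i j s ω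

/-- The time-space path of `X` stays in `C` on the whole of `[t,T]`, almost surely. -/
def StaysIn {d : ℕ} (P : Measure Ω) (T : ℝ) (C : Set (ℝ × Space d)) (t : ℝ)
    (X : ℝ → Ω → Space d) : Prop :=
  ∀ᵐ ω ∂P, ∀ s ∈ Set.Icc t T, (s, X s ω) ∈ C

end Probability

end ConstrainedSDE

end

noncomputable section

namespace ConstrainedSDE

variable {Ω : Type*} [mΩ : MeasurableSpace Ω]

/-! The proof localizes to compact sets on which the coefficients are Lipschitz and applies Grönwall
there. The sets `innerRegion T D n` are compact subsets of `𝒞_{[0,T)}`, and every compact subset of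
`𝒞_{[0,T)}` lies in one of them (`exists_subset_innerRegion`). On each of them `σ` and `μ + σα` are
Lipschitz in space with a single constant (`exists_lipschitz_innerRegion`).

Instead of exit times, the proof uses the events `A u` that both paths have stayed in the region on
`[t,u]`. They are adapted, decreasing in `u` and left-continuous (`IsLocalization`). With `Z` the
difference of the two solutions and `φ u = E[1_{A u} ‖Z u‖²]`, the equation and an energy estimate
for Itô integrals give `φ s ≤ C ∫_t^s φ`, so `φ = 0` (`ae_eq_zero_of_localized`,
`eq_zero_of_le_lintegral`).

The energy estimate `lintegral_localized_itoIntegral_sub_sq_le` is derived from the definition of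
the integral as a limit in probability. The discrete isometry is applied to sums cut off once the
localization ends or the accumulated squared error exceeds `ε` (`integral_localized_sq_le`). Fatou's
lemma then passes to refined grids, next to the approximating elementary integrands, and finally `ε
→ 0`. The price is a harmless factor 2.

Finally, each path restricted to `[t,q]` with `q < T` traces a compact subset of `𝒞_{[0,T)}`, hence
lies in some inner region. The solutions therefore agree at rational `q < T`, and by continuity on
all of `[t,T]`. Nothing is needed about `α` at time `T`. -/

/-- `B` has, on `[t,T]` and relative to `F`, the properties of a scalar Brownian motion that enter
the Itô isometry, together with path continuity. -/
structure IsBrownianRelative (P : Measure Ω) (F : ℝ → MeasurableSpace Ω) (t T : ℝ)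
    (B : ℝ → Ω → ℝ) : Prop where
  le : ∀ r ∈ Set.Icc t T, F r ≤ mΩ
  mono : ∀ r u, t ≤ r → r ≤ u → u ≤ T → F r ≤ F u
  adapted : ∀ r ∈ Set.Icc t T, Measurable[F r] (B r)
  memLp : ∀ r u, t ≤ r → r ≤ u → u ≤ T → MemLp (fun ω => B u ω - B r ω) 2 P
  mean : ∀ r u, t ≤ r → r ≤ u → u ≤ T → ∫ ω, (B u ω - B r ω) ∂P = 0
  second_moment : ∀ r u, t ≤ r → r ≤ u → u ≤ T → ∫ ω, (B u ω - B r ω) ^ 2 ∂P = u - r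
  indep : ∀ r u, t ≤ r → r ≤ u → u ≤ T → ∀ f : Ω → ℝ, Measurable[F r] f →
    IndepFun f (fun ω => B u ω - B r ω) P
  continuous : ∀ᵐ ω ∂P, ContinuousOn (fun s => B s ω) (Set.Icc t T)

/-! ### Brownian increments relative to the augmented filtration. -/

section Brownian

variable {d' : ℕ} {P : Measure Ω} {T : ℝ} {W : ℝ → Ω → Fin d' → ℝ}

lemma brownianFiltration_le (hW : IsBrownianMotionOn T W P) {s : ℝ} (hs : s ≤ T) :
    brownianFiltration P W s ≤ mΩ := by
  refine sup_le (iSup₂_le fun r hr => ?_) (MeasurableSpace.generateFrom_le fun A hA => hA.1)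
  exact (hW.measurable r ⟨hr.1, hr.2.trans hs⟩).comap_le

lemma brownianFiltration_mono {r s : ℝ} (hrs : r ≤ s) :
    brownianFiltration P W r ≤ brownianFiltration P W s := by
  refine sup_le_sup (iSup₂_le fun u hu => ?_) le_rfl
  exact le_iSup₂_of_le u ⟨hu.1, hu.2.trans hrs⟩ le_rfl

lemma measurable_brownianFiltration {s : ℝ} (hs : 0 ≤ s) :
    Measurable[brownianFiltration P W s] (W s) := by
  refine Measurable.of_comap_le (le_sup_of_le_left ?_)
  exact le_iSup₂_of_le s ⟨hs, le_rfl⟩ le_rfl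

/-- This lets a process be altered on a null event without losing adaptedness. -/
lemma measurableSet_brownianFiltration_of_null {s : ℝ} {A : Set Ω} (hA : MeasurableSet A)
    (hPA : P A = 0) : MeasurableSet[brownianFiltration P W s] A :=
  (le_sup_right : _ ≤ brownianFiltration P W s) _
    (MeasurableSpace.measurableSet_generateFrom ⟨hA, hPA⟩)

/-- Every event of the augmented filtration agrees almost surely with an event of the raw one. -/
lemma exists_raw_event_ae_eq {s : ℝ} {A : Set Ω} (hA : MeasurableSet[brownianFiltration P W s] A) :
    ∃ A', MeasurableSet[MeasurableSpace.comap (fun ω (r : Set.Icc 0 s) => W r ω)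
      inferInstance] A' ∧ A =ᵐ[P] A' := by
  -- The sets almost surely equal to a raw event form a σ-algebra, so only the generators need
  -- checking.
  have hle : brownianFiltration P W s ≤ eventuallyMeasurableSpace
      (MeasurableSpace.comap (fun ω (r : Set.Icc 0 s) => W r ω) inferInstance) (ae P) := by
    refine sup_le (iSup₂_le fun r hr => ?_) (MeasurableSpace.generateFrom_le fun A hA => ?_)
    · refine le_trans ?_ (le_eventuallyMeasurableSpace (l := ae P))
      refine Measurable.comap_le ?_
      exact (measurable_pi_apply (⟨r, hr⟩ : Set.Icc 0 s)).comp
        (comap_measurable (fun ω (r : Set.Icc 0 s) => W r ω))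
    · exact ⟨∅, @MeasurableSet.empty _ (_), (ae_eq_empty (μ := P)).2 hA.2⟩
  exact hle _ hA

/-- Augmentation preserves independence: replacing an event by an almost surely equal raw one
changes no probability in the product formula. -/
lemma indepFun_increment (hW : IsBrownianMotionOn T W P) {s u : ℝ} (hs : 0 ≤ s) (hsu : s ≤ u)
    (hu : u ≤ T) {f : Ω → ℝ} (hf : Measurable[brownianFiltration P W s] f) :
    IndepFun f (W u - W s) P := by
  have h := hW.indep_increment s u hs hsu hu
  rw [IndepFun_iff_Indep, Indep_iff] at h ⊢
  rintro _ B ⟨A, hA, rfl⟩ hB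
  obtain ⟨A', hA', hAA'⟩ := exists_raw_event_ae_eq (hf hA)
  rw [measure_congr hAA', measure_congr (hAA'.inter (ae_eq_refl B)), Set.inter_comm,
    h B A' hB hA', mul_comm]

lemma hasLaw_increment_apply (hW : IsBrownianMotionOn T W P) {s u : ℝ} (hs : 0 ≤ s) (hsu : s ≤ u)
    (hu : u ≤ T) (j : Fin d') :
    HasLaw (fun ω => W u ω j - W s ω j) (gaussianReal 0 (u - s).toNNReal) P :=
  (measurePreserving_eval (fun _ : Fin d' => gaussianReal 0 (u - s).toNNReal) j).fun_comp_hasLaw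
    (hW.hasLaw_increment s u hs hsu hu)

lemma isBrownianRelative (hW : IsBrownianMotionOn T W P) {t : ℝ} (ht : 0 ≤ t) (j : Fin d') :
    IsBrownianRelative P (brownianFiltration P W) t T (fun s ω => W s ω j) where
  le r hr := brownianFiltration_le hW hr.2
  mono r u _ h _ := brownianFiltration_mono h
  adapted r hr := (measurable_pi_apply j).comp (measurable_brownianFiltration (ht.trans hr.1))
  memLp r u hr hru hu := by
    have h := hasLaw_increment_apply hW (ht.trans hr) hru hu j
    have := memLp_id_gaussianReal (μ := 0) (v := (u - r).toNNReal) 2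
    rw [← h.map_eq] at this
    exact this.comp_of_map h.aemeasurable
  mean r u hr hru hu := by
    rw [(hasLaw_increment_apply hW (ht.trans hr) hru hu j).integral_eq, integral_id_gaussianReal]
  second_moment r u hr hru hu := by
    have h := hasLaw_increment_apply hW (ht.trans hr) hru hu j
    have hv := h.variance_eq
    rw [variance_of_integral_eq_zero h.aemeasurable
      (by rw [h.integral_eq, integral_id_gaussianReal]), variance_id_gaussianReal] at hv
    rw [hv, Real.coe_toNNReal _ (by linarith)]
  indep r u hr hru hu f hf :=
    (indepFun_increment hW (ht.trans hr) hru hu hf).comp measurable_id (measurable_pi_apply j)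
  continuous := by
    filter_upwards [hW.continuous] with ω hω
    exact (continuousOn_pi.1 hω j).mono (Set.Icc_subset_Icc_left ht)

end Brownian

/-! ### Discrete Itô isometry and its localized form. -/

section Isometry

variable {P : Measure Ω} {F : ℝ → MeasurableSpace Ω} {t T : ℝ}
  {B : ℝ → Ω → ℝ}

lemma memLp_two_bounded_mul {f g : Ω → ℝ} (hf : Measurable f) {c : ℝ} (hc : ∀ ω, |f ω| ≤ c)
    (hg : MemLp g 2 P) : MemLp (fun ω => f ω * g ω) 2 P := by
  refine MemLp.of_le_mul (c := c) hg (hf.aestronglyMeasurable.mul hg.1) (ae_of_all _ fun ω => ?_)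
  rw [norm_mul]
  exact mul_le_mul_of_nonneg_right (hc ω) (norm_nonneg _)

/-- The discrete Itô isometry. -/
lemma integral_sq_sum_increment [IsProbabilityMeasure P] (hB : IsBrownianRelative P F t T B)
    {r : ℕ → ℝ} (hr : Monotone r) {n : ℕ} (hrI : ∀ k ≤ n, r k ∈ Set.Icc t T) {y : ℕ → Ω → ℝ}
    (hy : ∀ k < n, Measurable[F (r k)] (y k)) (hyb : ∀ k < n, ∃ c, ∀ ω, |y k ω| ≤ c) :
    Measurable[F (r n)] (fun ω => ∑ k ∈ Finset.range n, y k ω * (B (r (k + 1)) ω - B (r k) ω)) ∧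
    MemLp (fun ω => ∑ k ∈ Finset.range n, y k ω * (B (r (k + 1)) ω - B (r k) ω)) 2 P ∧
    ∫ ω, (∑ k ∈ Finset.range n, y k ω * (B (r (k + 1)) ω - B (r k) ω)) ^ 2 ∂P =
      ∑ k ∈ Finset.range n, (∫ ω, y k ω ^ 2 ∂P) * (r (k + 1) - r k) := by
  induction n with
  | zero => simp
  | succ n ih =>
    obtain ⟨hm, hL, hI⟩ := ih (fun k hk => hrI k (by omega)) (fun k hk => hy k (by omega))
      (fun k hk => hyb k (by omega))
    simp only [Finset.sum_range_succ]
    set S : Ω → ℝ := fun ω => ∑ k ∈ Finset.range n, y k ω * (B (r (k + 1)) ω - B (r k) ω) with hS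
    have h0 := hrI n (by omega)
    have h1 := hrI (n + 1) le_rfl
    have h01 : r n ≤ r (n + 1) := hr (by omega)
    have hle : F (r n) ≤ F (r (n + 1)) := hB.mono _ _ h0.1 h01 h1.2
    have hyn := hy n (by omega)
    obtain ⟨c, hc⟩ := hyb n (by omega)
    have hyn' : Measurable (y n) := hyn.mono (hB.le _ h0) le_rfl
    have hBL := hB.memLp _ _ h0.1 h01 h1.2
    have hyL := memLp_two_bounded_mul hyn' hc hBL
    have hySL : MemLp (fun ω => y n ω * S ω) 2 P := memLp_two_bounded_mul hyn' hc hL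
    -- The factor `y n * S` is known at time `r n`, hence independent of the next increment, which
    -- has mean zero.
    have hcross : ∫ ω, (y n ω * S ω) * (B (r (n + 1)) ω - B (r n) ω) ∂P = 0 := by
      have := (hB.indep _ _ h0.1 h01 h1.2 _ (hyn.mul hm)).integral_fun_mul_eq_mul_integral
        hySL.1 hBL.1
      rw [hB.mean _ _ h0.1 h01 h1.2, mul_zero] at this
      exact this
    have hdiag : ∫ ω, y n ω ^ 2 * (B (r (n + 1)) ω - B (r n) ω) ^ 2 ∂P =
        (∫ ω, y n ω ^ 2 ∂P) * (r (n + 1) - r n) := by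
      have := ((hB.indep _ _ h0.1 h01 h1.2 _ hyn).comp (φ := fun x => x ^ 2) (ψ := fun x => x ^ 2)
        (by fun_prop) (by fun_prop)).integral_fun_mul_eq_mul_integral
        (by exact (hyn'.pow_const 2).aestronglyMeasurable) (by exact hBL.1.pow 2)
      rw [← hB.second_moment _ _ h0.1 h01 h1.2]
      exact this
    refine ⟨?_, hL.add hyL, ?_⟩
    · exact (hm.mono hle le_rfl).add ((hyn.mono hle le_rfl).mul
        ((hB.adapted _ h1).sub ((hB.adapted _ h0).mono hle le_rfl)))
    · have e : ∀ ω, (S ω + y n ω * (B (r (n + 1)) ω - B (r n) ω)) ^ 2 =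
          S ω ^ 2 + (2 * ((y n ω * S ω) * (B (r (n + 1)) ω - B (r n) ω)) +
            y n ω ^ 2 * (B (r (n + 1)) ω - B (r n) ω) ^ 2) := fun ω => by ring
      have i1 : Integrable (fun ω => S ω ^ 2) P := hL.integrable_sq
      have i2 : Integrable (fun ω => 2 * ((y n ω * S ω) * (B (r (n + 1)) ω - B (r n) ω))) P :=
        (hySL.integrable_mul hBL).const_mul 2
      have i3 : Integrable (fun ω => y n ω ^ 2 * (B (r (n + 1)) ω - B (r n) ω) ^ 2) P := by
        simpa only [mul_pow] using hyL.integrable_sq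
      have i23 : Integrable (fun ω => 2 * ((y n ω * S ω) * (B (r (n + 1)) ω - B (r n) ω)) +
            y n ω ^ 2 * (B (r (n + 1)) ω - B (r n) ω) ^ 2) P := i2.add i3
      rw [integral_congr_ae (ae_of_all _ e), integral_add i1 i23, integral_add i2 i3,
        integral_const_mul, hcross, hdiag, hI]
      ring

/-- Partial sums of nonnegative terms increase, so the retained terms form an initial segment whose
total is zero or a partial sum not exceeding `ε`. -/
lemma sum_indicator_partialSum_le {a : ℕ → ℝ} (ha : ∀ k, 0 ≤ a k) {ε : ℝ} (hε : 0 ≤ ε) (n : ℕ) :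
    ∑ k ∈ Finset.range n, (if ∑ j ∈ Finset.range (k + 1), a j ≤ ε then a k else 0) ≤ ε := by
  induction n with
  | zero => simpa
  | succ n ih =>
    rw [Finset.sum_range_succ]
    split_ifs with h
    · refine le_trans ?_ h
      rw [Finset.sum_range_succ]
      gcongr with k hk
      split_ifs
      exacts [le_rfl, ha k]
    · simpa using ih

open Classical in
/-- Localized energy estimate for discrete stochastic integrals: the second moment of
`∑ g_k ΔB_k`, restricted to events on which the localization `E` has not yet ended and on which the
localized quadratic mean of `g - h` is at most `ε`, is controlled by `h` and `ε`. -/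
lemma integral_localized_sq_le [IsProbabilityMeasure P] (hB : IsBrownianRelative P F t T B)
    {r : ℕ → ℝ} (hr : Monotone r) {n : ℕ} (hrI : ∀ k ≤ n, r k ∈ Set.Icc t T) {g h : ℕ → Ω → ℝ} {c : ℝ}
    (hg : ∀ k < n, Measurable[F (r k)] (g k)) (hgb : ∀ k ω, |g k ω| ≤ c)
    (hh : ∀ k < n, Measurable[F (r k)] (h k)) (hhb : ∀ k ω, |h k ω| ≤ c)
    {E : ℕ → Set Ω} (hE : ∀ k < n, MeasurableSet[F (r k)] (E k)) (hEn : ∀ k < n, E n ⊆ E k)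
    {ε : ℝ} (hε : 0 ≤ ε) :
    ∫⁻ ω, ENNReal.ofReal (if ω ∈ E n ∧ ∑ k ∈ Finset.range n,
        (E k).indicator (fun ω => (g k ω - h k ω) ^ 2) ω * (r (k + 1) - r k) ≤ ε then
          (∑ k ∈ Finset.range n, g k ω * (B (r (k + 1)) ω - B (r k) ω)) ^ 2 else 0) ∂P ≤
      ENNReal.ofReal (2 * ∫ ω, ∑ k ∈ Finset.range n,
        (E k).indicator (fun ω => h k ω ^ 2) ω * (r (k + 1) - r k) ∂P + 2 * ε) := by
  have hΔ : ∀ k, 0 ≤ r (k + 1) - r k := fun k => sub_nonneg.2 (hr (by omega))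
  set a : ℕ → Ω → ℝ := fun k ω =>
    (E k).indicator (fun ω => (g k ω - h k ω) ^ 2) ω * (r (k + 1) - r k) with ha
  have ha0 : ∀ k ω, 0 ≤ a k ω := fun k ω =>
    mul_nonneg (Set.indicator_nonneg (fun _ _ => sq_nonneg _) _) (hΔ k)
  -- The partial sum includes the `k`-th error term, which is already known at time `r k`. The
  -- cutoff is thus adapted, and the error it retains never exceeds `ε`, even on paths whose total
  -- error is large.
  set D : ℕ → Set Ω := fun k => {ω | ∑ j ∈ Finset.range (k + 1), a j ω ≤ ε} with hD
  set y : ℕ → Ω → ℝ := fun k => (E k ∩ D k).indicator (g k) with hy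
  have hle : ∀ j k, j ≤ k → k ≤ n → F (r j) ≤ F (r k) := fun j k hjk hk =>
    hB.mono _ _ (hrI j (by omega)).1 (hr hjk) (hrI k hk).2
  have ham : ∀ j k, j ≤ k → k < n → Measurable[F (r k)] (a j) := fun j k hjk hk =>
    ((Measurable.indicator (((hg j (by omega)).sub (hh j (by omega))).pow_const 2)
      (hE j (by omega))).mul_const _).mono (hle j k hjk hk.le) le_rfl
  have hDm : ∀ k < n, MeasurableSet[F (r k)] (D k) := fun k hk => by
    have : Measurable[F (r k)] (fun ω => ∑ j ∈ Finset.range (k + 1), a j ω) :=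
      Finset.measurable_fun_sum _ fun j hj => ham j k (by simp at hj; omega) hk
    exact this measurableSet_Iic
  have hym : ∀ k < n, Measurable[F (r k)] (y k) := fun k hk =>
    (hg k hk).indicator ((hE k hk).inter (hDm k hk))
  have hc0 : ∀ ω : Ω, 0 ≤ c := fun ω => (abs_nonneg _).trans (hgb 0 ω)
  have hyb : ∀ k ω, |y k ω| ≤ c := fun k ω => by
    simp only [hy, Set.indicator]
    split_ifs
    exacts [hgb k ω, by simpa using hc0 ω]
  obtain ⟨hm, hL, hI⟩ := integral_sq_sum_increment hB hr hrI hym (fun k _ => ⟨c, hyb k⟩)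
  have hstep : ∀ ω, (if ω ∈ E n ∧ ∑ k ∈ Finset.range n, a k ω ≤ ε then
      (∑ k ∈ Finset.range n, g k ω * (B (r (k + 1)) ω - B (r k) ω)) ^ 2 else 0) ≤
      (∑ k ∈ Finset.range n, y k ω * (B (r (k + 1)) ω - B (r k) ω)) ^ 2 := by
    intro ω
    split_ifs with hω
    · refine le_of_eq ?_
      congr 1
      refine Finset.sum_congr rfl fun k hk => ?_
      have hk' := Finset.mem_range.1 hk
      have : ω ∈ E k ∩ D k := by
        refine ⟨hEn k hk' hω.1, le_trans ?_ hω.2⟩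
        exact Finset.sum_le_sum_of_subset_of_nonneg (Finset.range_mono (by omega))
          fun i _ _ => ha0 i ω
      simp only [hy, Set.indicator_of_mem this]
    · positivity
  have hyi : ∀ k < n, Integrable (fun ω => y k ω ^ 2) P := fun k hk => by
    have hkm : Measurable (y k) := (hym k hk).mono (hB.le _ (hrI k hk.le)) le_rfl
    refine Integrable.of_bound (hkm.pow_const 2).aestronglyMeasurable (c ^ 2)
      (ae_of_all _ fun ω => ?_)
    rw [Real.norm_of_nonneg (sq_nonneg _)]
    exact sq_le_sq' (by linarith [neg_le_of_abs_le (hyb k ω)]) (le_of_abs_le (hyb k ω))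
  have hhi : ∀ k < n, Integrable (fun ω =>
      (E k).indicator (fun ω => h k ω ^ 2) ω * (r (k + 1) - r k)) P := fun k hk => by
    have hkm : Measurable (h k) := (hh k hk).mono (hB.le _ (hrI k hk.le)) le_rfl
    refine Integrable.mul_const (Integrable.indicator ?_ (hB.le _ (hrI k hk.le) _ (hE k hk))) _
    refine Integrable.of_bound (hkm.pow_const 2).aestronglyMeasurable (c ^ 2)
      (ae_of_all _ fun ω => ?_)
    rw [Real.norm_of_nonneg (sq_nonneg _)]
    exact sq_le_sq' (by linarith [neg_le_of_abs_le (hhb k ω)]) (le_of_abs_le (hhb k ω))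
  calc _ ≤ ∫⁻ ω, ENNReal.ofReal
        ((∑ k ∈ Finset.range n, y k ω * (B (r (k + 1)) ω - B (r k) ω)) ^ 2) ∂P :=
        lintegral_mono fun ω => ENNReal.ofReal_le_ofReal (hstep ω)
    _ = ENNReal.ofReal (∫ ω, (∑ k ∈ Finset.range n,
          y k ω * (B (r (k + 1)) ω - B (r k) ω)) ^ 2 ∂P) :=
        (ofReal_integral_eq_lintegral_ofReal hL.integrable_sq
          (ae_of_all _ fun ω => sq_nonneg _)).symm
    _ ≤ _ := ENNReal.ofReal_le_ofReal ?_
  rw [hI]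
  simp only [← integral_mul_const]
  rw [← integral_finsetSum _ fun k hk => (hyi k (Finset.mem_range.1 hk)).mul_const _]
  have hs : Integrable (fun ω => ∑ k ∈ Finset.range n,
      (E k).indicator (fun ω => h k ω ^ 2) ω * (r (k + 1) - r k)) P :=
    integrable_finsetSum _ fun k hk => hhi k (Finset.mem_range.1 hk)
  have hrhs : 2 * ∫ ω, ∑ k ∈ Finset.range n,
        (E k).indicator (fun ω => h k ω ^ 2) ω * (r (k + 1) - r k) ∂P + 2 * ε =
      ∫ ω, (2 * ∑ k ∈ Finset.range n,
        (E k).indicator (fun ω => h k ω ^ 2) ω * (r (k + 1) - r k)) + 2 * ε ∂P := by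
    rw [integral_add (hs.const_mul 2) (integrable_const _), integral_const_mul]
    simp
  rw [hrhs]
  refine integral_mono (integrable_finsetSum _ fun k hk =>
    (hyi k (Finset.mem_range.1 hk)).mul_const _) ((hs.const_mul 2).add (integrable_const _))
    fun ω => ?_
  have hbd := sum_indicator_partialSum_le (fun k => ha0 k ω) hε n
  calc ∑ k ∈ Finset.range n, y k ω ^ 2 * (r (k + 1) - r k)
      ≤ ∑ k ∈ Finset.range n, (2 * ((E k).indicator (fun ω => h k ω ^ 2) ω * (r (k + 1) - r k)) +
          2 * (if ∑ j ∈ Finset.range (k + 1), a j ω ≤ ε then a k ω else 0)) := by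
        refine Finset.sum_le_sum fun k _ => ?_
        by_cases hEk : ω ∈ E k
        · by_cases hDk : ω ∈ D k
          · have hDk' : ∑ j ∈ Finset.range (k + 1), a j ω ≤ ε := hDk
            rw [if_pos hDk']
            simp only [hy, Set.indicator_of_mem (show ω ∈ E k ∩ D k from ⟨hEk, hDk⟩),
              ha, Set.indicator_of_mem hEk]
            nlinarith [mul_nonneg (hΔ k) (sq_nonneg (g k ω - 2 * h k ω))]
          · have : ω ∉ E k ∩ D k := fun h => hDk h.2
            have hDk' : ¬ ∑ j ∈ Finset.range (k + 1), a j ω ≤ ε := hDk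
            simp only [hy, Set.indicator_of_notMem this, if_neg hDk', Set.indicator_of_mem hEk]
            have := mul_nonneg (sq_nonneg (h k ω)) (hΔ k)
            nlinarith
        · have : ω ∉ E k ∩ D k := fun h => hEk h.1
          simp only [hy, Set.indicator_of_notMem this, ha, Set.indicator_of_notMem hEk]
          simp
    _ = 2 * ∑ k ∈ Finset.range n, ((E k).indicator (fun ω => h k ω ^ 2) ω * (r (k + 1) - r k)) +
          2 * ∑ k ∈ Finset.range n,
            (if ∑ j ∈ Finset.range (k + 1), a j ω ≤ ε then a k ω else 0) := by
        rw [Finset.sum_add_distrib, Finset.mul_sum, Finset.mul_sum]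
    _ ≤ _ := by linarith

end Isometry

end ConstrainedSDE

namespace ConstrainedSDE

/-! ### Uniform grids and left Riemann sums. -/

section Grid

/-- The `k`-th point of the uniform grid with `m` cells on `[t,s]`. -/
def gridPoint (t s : ℝ) (m k : ℕ) : ℝ := t + k * ((s - t) / m)

variable {t s : ℝ}

lemma gridPoint_zero (m : ℕ) : gridPoint t s m 0 = t := by simp [gridPoint]

lemma gridPoint_self {m : ℕ} (hm : 0 < m) : gridPoint t s m m = s := by
  have : (m : ℝ) ≠ 0 := by positivity
  simp only [gridPoint]
  field_simp
  ring

lemma gridPoint_monotone (hts : t ≤ s) (m : ℕ) : Monotone (gridPoint t s m) := fun i j hij => by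
  have : 0 ≤ (s - t) / m := div_nonneg (sub_nonneg.2 hts) (by positivity)
  simp only [gridPoint]
  gcongr

lemma gridPoint_mem (hts : t ≤ s) {m k : ℕ} (hm : 0 < m) (hk : k ≤ m) :
    gridPoint t s m k ∈ Set.Icc t s := by
  constructor
  · simpa [gridPoint_zero] using gridPoint_monotone hts m (Nat.zero_le k)
  · simpa [gridPoint_self hm] using gridPoint_monotone hts m hk

lemma gridPoint_succ_sub (m k : ℕ) :
    gridPoint t s m (k + 1) - gridPoint t s m k = (s - t) / m := by
  simp only [gridPoint]
  push_cast
  ring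

lemma tendsto_gridStep (t s : ℝ) : Tendsto (fun m : ℕ => (s - t) / m) atTop (𝓝 0) :=
  tendsto_const_nhds.div_atTop tendsto_natCast_atTop_atTop

/-- The last grid point strictly before `u`. -/
def leftGrid (t s : ℝ) (m : ℕ) (u : ℝ) : ℝ := gridPoint t s m (⌈(u - t) / ((s - t) / m)⌉₊ - 1)

lemma leftGrid_eq (hts : t < s) {m k : ℕ} (hm : 0 < m) {u : ℝ}
    (hu : u ∈ Set.Ioc (gridPoint t s m k) (gridPoint t s m (k + 1))) :
    leftGrid t s m u = gridPoint t s m k := by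
  have hδ : 0 < (s - t) / m := div_pos (sub_pos.2 hts) (by positivity)
  have : ⌈(u - t) / ((s - t) / m)⌉₊ = k + 1 := by
    rw [Nat.ceil_eq_iff (by omega)]
    obtain ⟨h1, h2⟩ := hu
    simp only [gridPoint] at h1 h2
    constructor
    · rw [lt_div_iff₀ hδ]; simp; linarith
    · rw [div_le_iff₀ hδ]; linarith
  simp [leftGrid, this]

lemma leftGrid_lt (hts : t < s) {m : ℕ} (hm : 0 < m) {u : ℝ} (hu : t < u) :
    leftGrid t s m u < u ∧ u - (s - t) / m ≤ leftGrid t s m u := by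
  have hδ : 0 < (s - t) / m := div_pos (sub_pos.2 hts) (by positivity)
  set x := (u - t) / ((s - t) / m) with hx
  have hx0 : 0 < x := div_pos (sub_pos.2 hu) hδ
  have hu' : u = t + x * ((s - t) / m) := by rw [hx, div_mul_cancel₀ _ hδ.ne']; ring
  have h1 : 1 ≤ ⌈x⌉₊ := Nat.one_le_ceil_iff.2 hx0
  have h2 := Nat.ceil_lt_add_one hx0.le
  have h3 := Nat.le_ceil x
  simp only [leftGrid, ← hx, gridPoint]
  push_cast [Nat.cast_sub h1]
  constructor
  · rw [hu']; nlinarith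
  · rw [hu']; nlinarith

/-- The approach is strictly from the left, so left-continuity of an integrand suffices for
convergence of its left Riemann sums. -/
lemma tendsto_leftGrid (hts : t < s) {u : ℝ} (hu : t < u) :
    Tendsto (fun m => leftGrid t s m u) atTop (𝓝[<] u) := by
  refine tendsto_nhdsWithin_iff.2 ⟨?_, ?_⟩
  · refine tendsto_of_tendsto_of_tendsto_of_le_of_le' (g := fun m : ℕ => u - (s - t) / m)
      (h := fun _ => u) ?_ tendsto_const_nhds ?_ ?_
    · simpa using tendsto_const_nhds.sub (tendsto_gridStep t s)
    · filter_upwards [eventually_gt_atTop 0] with m hm using (leftGrid_lt hts hm hu).2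
    · filter_upwards [eventually_gt_atTop 0] with m hm using (leftGrid_lt hts hm hu).1.le
  · filter_upwards [eventually_gt_atTop 0] with m hm using (leftGrid_lt hts hm hu).1

/-- Left Riemann sums of a bounded left-continuous function converge to its integral. -/
lemma tendsto_leftRiemannSum (hts : t < s) {f : ℝ → ℝ} {c : ℝ} (hc : ∀ u, |f u| ≤ c)
    (hf : ∀ u ∈ Set.Ioc t s, Tendsto f (𝓝[<] u) (𝓝 (f u))) :
    Tendsto (fun m : ℕ => ∑ k ∈ Finset.range m,
      f (gridPoint t s m k) * (gridPoint t s m (k + 1) - gridPoint t s m k)) atTop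
      (𝓝 (∫ u in t..s, f u)) := by
  -- No measurability of `f` is needed: the composite factors through the natural-number index of
  -- the cell.
  have hmeas : ∀ m, Measurable fun u => f (leftGrid t s m u) := fun m => by
    have h1 : Measurable fun u : ℝ => ⌈(u - t) / ((s - t) / m)⌉₊ - 1 := by fun_prop
    have h2 : Measurable fun k : ℕ => f (gridPoint t s m k) := measurable_from_nat
    exact h2.comp h1
  have key : ∀ m : ℕ, 0 < m → ∑ k ∈ Finset.range m,
      f (gridPoint t s m k) * (gridPoint t s m (k + 1) - gridPoint t s m k) =
      ∫ u in t..s, f (leftGrid t s m u) := fun m hm => by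
    have hint : ∀ a b : ℝ, IntervalIntegrable (fun u => f (leftGrid t s m u)) volume a b :=
      fun a b => (intervalIntegrable_const (c := c)).mono_fun (hmeas m).aestronglyMeasurable
        (ae_of_all _ fun u => (hc _).trans (le_abs_self c))
    have := intervalIntegral.sum_integral_adjacent_intervals (n := m) (a := gridPoint t s m)
      (fun k _ => hint (gridPoint t s m k) (gridPoint t s m (k + 1)))
    rw [gridPoint_zero, gridPoint_self hm] at this
    rw [← this]
    refine Finset.sum_congr rfl fun k _ => ?_
    have hk : gridPoint t s m k ≤ gridPoint t s m (k + 1) :=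
      gridPoint_monotone hts.le m (Nat.le_succ k)
    rw [intervalIntegral.integral_congr_ae (g := fun _ => f (gridPoint t s m k))]
    · simp [mul_comm]
    · refine ae_of_all _ fun u hu => ?_
      rw [Set.uIoc_of_le hk] at hu
      rw [leftGrid_eq hts hm hu]
  refine Tendsto.congr' (f₁ := fun m => ∫ u in t..s, f (leftGrid t s m u)) ?_ ?_
  · filter_upwards [eventually_gt_atTop 0] with m hm using (key m hm).symm
  · refine intervalIntegral.tendsto_integral_filter_of_dominated_convergence (fun _ => c)
      (Eventually.of_forall fun m => (hmeas m).aestronglyMeasurable)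
      (Eventually.of_forall fun m => ae_of_all _ fun u _ => hc _) intervalIntegrable_const
      (ae_of_all _ fun u hu => ?_)
    rw [Set.uIoc_of_le hts.le] at hu
    exact (hf u hu).comp (tendsto_leftGrid hts hu.1)

/-- The grid points up to `b` form an initial segment, so the sum telescopes. Its last endpoint
overshoots `min b s` by at most one mesh width. -/
lemma tendsto_sum_increment_le {T : ℝ} (hts : t < s) (hsT : s ≤ T) {β : ℝ → ℝ}
    (hβ : ContinuousOn β (Set.Icc t T)) {b : ℝ} (hb : t ≤ b) :
    Tendsto (fun m : ℕ => ∑ k ∈ Finset.range m, (if gridPoint t s m k ≤ b then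
      (β (gridPoint t s m (k + 1)) - β (gridPoint t s m k)) else 0)) atTop
      (𝓝 (β (min b s) - β t)) := by
  set N : ℕ → ℕ := fun m => min m (⌊(b - t) / ((s - t) / m)⌋₊ + 1) with hN
  have hsum : ∀ m : ℕ, 0 < m → ∑ k ∈ Finset.range m, (if gridPoint t s m k ≤ b then
      (β (gridPoint t s m (k + 1)) - β (gridPoint t s m k)) else 0) =
      β (gridPoint t s m (N m)) - β t := fun m hm => by
    have hδ : 0 < (s - t) / m := div_pos (sub_pos.2 hts) (by positivity)
    have hfil : (Finset.range m).filter (fun k => gridPoint t s m k ≤ b) = Finset.range (N m) := by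
      ext k
      have : gridPoint t s m k ≤ b ↔ k < ⌊(b - t) / ((s - t) / m)⌋₊ + 1 := by
        rw [Nat.lt_succ_iff, Nat.le_floor_iff (div_nonneg (sub_nonneg.2 hb) hδ.le),
          le_div_iff₀ hδ, gridPoint]
        constructor <;> intro h <;> linarith
      simp [hN, this]
    rw [← Finset.sum_filter, hfil, Finset.sum_range_sub (fun k => β (gridPoint t s m k)),
      gridPoint_zero]
  have hbd : ∀ m : ℕ, 0 < m → min b s ≤ gridPoint t s m (N m) ∧
      gridPoint t s m (N m) ≤ min b s + (s - t) / m := fun m hm => by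
    have hδ : 0 < (s - t) / m := div_pos (sub_pos.2 hts) (by positivity)
    set x := (b - t) / ((s - t) / m) with hx
    have hx0 : 0 ≤ x := div_nonneg (sub_nonneg.2 hb) hδ.le
    have hb' : b = t + x * ((s - t) / m) := by rw [hx, div_mul_cancel₀ _ hδ.ne']; ring
    have h1 := Nat.lt_floor_add_one x
    have h2 := Nat.floor_le hx0
    have hlow : b ≤ gridPoint t s m (⌊x⌋₊ + 1) := by
      simp only [gridPoint]; push_cast; nlinarith
    have hup : gridPoint t s m (⌊x⌋₊ + 1) ≤ b + (s - t) / m := by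
      simp only [gridPoint]; push_cast; nlinarith
    have hmon := gridPoint_monotone hts.le m
    have hNe : gridPoint t s m (N m) = min s (gridPoint t s m (⌊x⌋₊ + 1)) := by
      rw [hN]; simp only [← hx]
      rw [hmon.map_min, gridPoint_self hm]
    rw [hNe]
    constructor
    · rw [min_comm b s]; exact min_le_min le_rfl hlow
    · rw [min_comm b s, ← min_add_add_right]
      exact min_le_min (by linarith) hup
  have hlim : Tendsto (fun m => gridPoint t s m (N m)) atTop (𝓝[Set.Icc t T] (min b s)) := by
    refine tendsto_nhdsWithin_iff.2 ⟨?_, ?_⟩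
    · refine tendsto_of_tendsto_of_tendsto_of_le_of_le' (g := fun _ => min b s)
        (h := fun m : ℕ => min b s + (s - t) / m) tendsto_const_nhds ?_ ?_ ?_
      · simpa using tendsto_const_nhds.add (tendsto_gridStep t s)
      · filter_upwards [eventually_gt_atTop 0] with m hm using (hbd m hm).1
      · filter_upwards [eventually_gt_atTop 0] with m hm using (hbd m hm).2
    · filter_upwards [eventually_gt_atTop 0] with m hm
      have := gridPoint_mem hts.le hm (min_le_left m (⌊(b - t) / ((s - t) / m)⌋₊ + 1))
      exact ⟨this.1, this.2.trans hsT⟩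
  have hmem : min b s ∈ Set.Icc t T := ⟨le_min hb hts.le, (min_le_right _ _).trans hsT⟩
  refine Tendsto.congr' ?_ (((hβ _ hmem).tendsto.comp hlim).sub_const (β t))
  filter_upwards [eventually_gt_atTop 0] with m hm using (hsum m hm).symm

end Grid

/-! ### Elementary integrands as left-continuous processes. -/

namespace ElementaryProcess

variable {Ω : Type*} {F : ℝ → MeasurableSpace Ω} {t T : ℝ}

lemma tendsto_value_left (G : ElementaryProcess F t T) (ω : Ω) (u : ℝ) :
    Tendsto (fun v => G.value v ω) (𝓝[<] u) (𝓝 (G.value u ω)) := by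
  refine tendsto_finsetSum _ fun k _ => tendsto_nhds_of_eventually_eq ?_
  by_cases h1 : u ≤ G.τ k
  · filter_upwards [self_mem_nhdsWithin] with v hv
    rw [Set.indicator_of_notMem fun h => absurd h.1 (not_lt.2 ((Set.mem_Iio.1 hv).le.trans h1)),
      Set.indicator_of_notMem fun h => absurd h.1 (not_lt.2 h1)]
  push Not at h1
  by_cases h2 : u ≤ G.τ (k + 1)
  · filter_upwards [Ioo_mem_nhdsLT h1] with v hv
    rw [Set.indicator_of_mem (show v ∈ Set.Ioc _ _ from ⟨hv.1, hv.2.le.trans h2⟩),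
      Set.indicator_of_mem (show u ∈ Set.Ioc _ _ from ⟨h1, h2⟩)]
  push Not at h2
  filter_upwards [Ioo_mem_nhdsLT h2] with v hv
  rw [Set.indicator_of_notMem fun h => absurd h.2 (not_le.2 hv.1),
    Set.indicator_of_notMem fun h => absurd h.2 (not_le.2 h2)]

lemma exists_abs_value_le (G : ElementaryProcess F t T) : ∃ c, ∀ u ω, |G.value u ω| ≤ c := by
  choose c hc using G.bounded_height
  refine ⟨∑ k ∈ Finset.range G.n, c k, fun u ω => ?_⟩
  refine (Finset.abs_sum_le_sum_abs _ _).trans (Finset.sum_le_sum fun k _ => ?_)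
  by_cases h : u ∈ Set.Ioc (G.τ k) (G.τ (k + 1))
  · simpa [Set.indicator_of_mem h] using hc k ω
  · simpa [Set.indicator_of_notMem h] using (abs_nonneg _).trans (hc k ω)

lemma measurable_value_time (G : ElementaryProcess F t T) (ω : Ω) :
    Measurable fun u => G.value u ω :=
  Finset.measurable_fun_sum _ fun _ _ => measurable_const.indicator measurableSet_Ioc

lemma measurable_value (G : ElementaryProcess F t T)
    (hF : ∀ r u, t ≤ r → r ≤ u → u ≤ T → F r ≤ F u) {u : ℝ} (hu : u ∈ Set.Icc t T) :
    Measurable[F u] (G.value u) := by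
  refine Finset.measurable_fun_sum _ fun k _ => ?_
  by_cases h : u ∈ Set.Ioc (G.τ k) (G.τ (k + 1))
  · simp only [Set.indicator_of_mem h]
    exact (G.measurable_height k).mono (hF _ _ (G.time_mem k).1 h.1.le hu.2) le_rfl
  · simp only [Set.indicator_of_notMem h]
    exact measurable_const

/-- The indicator of `(τ_i, τ_{i+1}]` is the difference of those of `(-∞, τ_{i+1}]` and `(-∞, τ_i]`,
and each of these telescopes in the limit. This rewrites elementary integrals over a common uniform
grid, whatever their own partitions. -/
lemma tendsto_sum_value_mul_increment (G : ElementaryProcess F t T) {s : ℝ} (hts : t < s)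
    (hsT : s ≤ T) {B : ℝ → Ω → ℝ} {ω : Ω}
    (hB : ContinuousOn (fun u => B u ω) (Set.Icc t T)) :
    Tendsto (fun m : ℕ => ∑ k ∈ Finset.range m, G.value (gridPoint t s m k) ω *
      (B (gridPoint t s m (k + 1)) ω - B (gridPoint t s m k) ω)) atTop
      (𝓝 (G.integral B s ω)) := by
  have h : ∀ i, Tendsto (fun m : ℕ => G.ξ i ω *
      (∑ k ∈ Finset.range m, (if gridPoint t s m k ≤ G.τ (i + 1) then
        (B (gridPoint t s m (k + 1)) ω - B (gridPoint t s m k) ω) else 0) -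
      ∑ k ∈ Finset.range m, (if gridPoint t s m k ≤ G.τ i then
        (B (gridPoint t s m (k + 1)) ω - B (gridPoint t s m k) ω) else 0))) atTop
      (𝓝 (G.ξ i ω * (B (min (G.τ (i + 1)) s) ω - B (min (G.τ i) s) ω))) := fun i => by
    have := ((tendsto_sum_increment_le hts hsT hB (G.time_mem (i + 1)).1).sub
      (tendsto_sum_increment_le hts hsT hB (G.time_mem i).1)).const_mul (G.ξ i ω)
    simpa only [sub_sub_sub_cancel_right] using this
  refine (tendsto_finsetSum (Finset.range G.n) fun i _ => h i).congr fun m => ?_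
  simp only [value, Finset.sum_mul, ← Finset.sum_sub_distrib, Finset.mul_sum]
  rw [Finset.sum_comm]
  refine Finset.sum_congr rfl fun k _ => Finset.sum_congr rfl fun i _ => ?_
  have hτ : G.τ i ≤ G.τ (i + 1) := G.monotone_time (Nat.le_succ i)
  simp only [Set.indicator, Set.mem_Ioc]
  split_ifs
  all_goals first | ring1 | (exfalso; grind)

end ElementaryProcess

end ConstrainedSDE

/-! ### Localizations, truncation and the energy estimate for limits of Riemann sums. -/

namespace ConstrainedSDE

variable {Ω : Type*}

/-- Cauchy–Schwarz against the constant 1, obtained by expanding `∫ (f - l)² ≥ 0` with `l` the mean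
of `f`. -/
lemma sq_intervalIntegral_le {a b : ℝ} (hab : a ≤ b) {f : ℝ → ℝ}
    (hf : IntervalIntegrable f volume a b)
    (hf2 : IntervalIntegrable (fun u => f u ^ 2) volume a b) :
    (∫ u in a..b, f u) ^ 2 ≤ (b - a) * ∫ u in a..b, f u ^ 2 := by
  rcases hab.eq_or_lt with rfl | hlt
  · simp
  set l := (∫ u in a..b, f u) / (b - a) with hl
  have h0 : 0 ≤ ∫ u in a..b, (f u - l) ^ 2 :=
    intervalIntegral.integral_nonneg hab fun u _ => sq_nonneg _
  have e : ∀ u, (f u - l) ^ 2 = f u ^ 2 - 2 * l * f u + l ^ 2 := fun u => by ring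
  simp only [e] at h0
  rw [intervalIntegral.integral_add (hf2.sub (hf.const_mul _)) intervalIntegrable_const,
    intervalIntegral.integral_sub hf2 (hf.const_mul _), intervalIntegral.integral_const_mul,
    intervalIntegral.integral_const] at h0
  have hba : 0 < b - a := sub_pos.2 hlt
  have hI : ∫ u in a..b, f u = l * (b - a) := by rw [hl]; field_simp
  rw [hI] at h0 ⊢
  simp only [smul_eq_mul] at h0
  nlinarith

/-- Fatou lemma for upper bounds. -/
lemma lintegral_le_of_ae_le_liminf [MeasurableSpace Ω] {P : Measure Ω} {f : Ω → ENNReal}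
    {F : ℕ → Ω → ENNReal} {b : ℕ → ENNReal} {C : ENNReal} (hF : ∀ n, AEMeasurable (F n) P)
    (hfF : ∀ᵐ ω ∂P, f ω ≤ liminf (fun n => F n ω) atTop) (hFb : ∀ n, ∫⁻ ω, F n ω ∂P ≤ b n)
    (hb : Tendsto b atTop (𝓝 C)) : ∫⁻ ω, f ω ∂P ≤ C :=
  calc ∫⁻ ω, f ω ∂P ≤ ∫⁻ ω, liminf (fun n => F n ω) atTop ∂P := lintegral_mono_ae hfF
    _ ≤ liminf (fun n => ∫⁻ ω, F n ω ∂P) atTop := lintegral_liminf_le' hF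
    _ ≤ liminf b atTop := liminf_le_liminf (Eventually.of_forall hFb)
    _ = C := hb.liminf_eq

/-- A decreasing, left-continuous family of events on `[t,s]`, adapted to `F`: the events that a
localization has not ended yet. -/
structure IsLocalization (F : ℝ → MeasurableSpace Ω) (t s : ℝ) (A : ℝ → Set Ω) : Prop where
  measurableSet : ∀ u ∈ Set.Icc t s, MeasurableSet[F u] (A u)
  anti : ∀ u v, t ≤ u → u ≤ v → v ≤ s → A v ⊆ A u
  left : ∀ u ∈ Set.Ioc t s, ∀ ω, (∀ v ∈ Set.Ico t u, ω ∈ A v) → ω ∈ A u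

/-- A bounded adapted process with left-continuous paths on `[t,s]`. -/
structure IsRegularIntegrand (F : ℝ → MeasurableSpace Ω) (t s : ℝ) (g : ℝ → Ω → ℝ) : Prop where
  measurable : ∀ u ∈ Set.Icc t s, Measurable[F u] (g u)
  bounded : ∃ c, ∀ u ω, |g u ω| ≤ c
  left : ∀ u ω, Tendsto (fun v => g v ω) (𝓝[<] u) (𝓝 (g u ω))

variable {F : ℝ → MeasurableSpace Ω} {t s : ℝ} {A : ℝ → Set Ω} {g h : ℝ → Ω → ℝ}

lemma IsRegularIntegrand.sub (hg : IsRegularIntegrand F t s g) (hh : IsRegularIntegrand F t s h) :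
    IsRegularIntegrand F t s (fun u ω => g u ω - h u ω) where
  measurable u hu := (hg.measurable u hu).sub (hh.measurable u hu)
  bounded := by
    obtain ⟨c, hc⟩ := hg.bounded
    obtain ⟨c', hc'⟩ := hh.bounded
    exact ⟨c + c', fun u ω => (abs_sub _ _).trans (add_le_add (hc u ω) (hc' u ω))⟩
  left u ω := (hg.left u ω).sub (hh.left u ω)

lemma IsRegularIntegrand.sq (hg : IsRegularIntegrand F t s g) :
    IsRegularIntegrand F t s (fun u ω => g u ω ^ 2) where
  measurable u hu := (hg.measurable u hu).pow_const 2
  bounded := by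
    obtain ⟨c, hc⟩ := hg.bounded
    refine ⟨c ^ 2, fun u ω => ?_⟩
    rw [abs_pow]
    exact pow_le_pow_left₀ (abs_nonneg _) (hc u ω) 2
  left u ω := (hg.left u ω).pow 2

/-- Truncation of a real number to `[-c,c]`. -/
def clip (c x : ℝ) : ℝ := max (-c) (min c x)

lemma continuous_clip (c : ℝ) : Continuous (clip c) := by unfold clip; fun_prop

lemma abs_clip_le {c : ℝ} (hc : 0 ≤ c) (x : ℝ) : |clip c x| ≤ c :=
  abs_le.2 ⟨le_max_left _ _, max_le (by linarith) (min_le_left _ _)⟩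

lemma clip_of_abs_le {c x : ℝ} (hx : |x| ≤ c) : clip c x = x := by
  rw [clip, min_eq_right (le_of_abs_le hx), max_eq_right (neg_le_of_abs_le hx)]

lemma abs_clip_sub_clip_le (c x y : ℝ) : |clip c x - clip c y| ≤ |x - y| := by
  simp only [clip]
  refine (abs_max_sub_max_le_max _ _ _ _).trans ?_
  simp only [sub_self, abs_zero]
  refine max_le (abs_nonneg _) ((abs_min_sub_min_le_max _ _ _ _).trans ?_)
  simp

/-- Clipping is the nearest-point projection onto `[-c,c]`, and `y` lies in that interval. Where the
true integrand is bounded by `c`, clipping an approximation therefore moves it by no more than its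
own error. -/
lemma abs_sub_clip_le {c x y : ℝ} (hy : |y| ≤ c) : |x - clip c x| ≤ |x - y| := by
  have := abs_le.1 hy
  rw [clip]
  rcases le_total x c with h1 | h1
  · rw [min_eq_right h1]
    rcases le_total (-c) x with h2 | h2
    · rw [max_eq_right h2]; simp
    · rw [max_eq_left h2, abs_of_nonpos (by linarith), abs_of_nonpos (by linarith)]; linarith
  · rw [min_eq_left h1, max_eq_right (by linarith), abs_of_nonneg (by linarith),
      abs_of_nonneg (by linarith)]
    linarith

lemma IsRegularIntegrand.clip (hg : IsRegularIntegrand F t s g) {c : ℝ} (hc : 0 ≤ c) :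
    IsRegularIntegrand F t s (fun u ω => clip c (g u ω)) where
  measurable u hu := (continuous_clip c).measurable.comp (hg.measurable u hu)
  bounded := ⟨c, fun _ _ => abs_clip_le hc _⟩
  left u ω := ((continuous_clip c).tendsto _).comp (hg.left u ω)

/-- If `ω` is alive at `u`, it is alive at all earlier times. If not, left-continuity of the
localization gives an ending strictly before `u`, so the indicator vanishes near `u` on the left. -/
lemma IsLocalization.tendsto_indicator (hA : IsLocalization F t s A)
    (hg : IsRegularIntegrand F t s g) {u : ℝ} (hu : u ∈ Set.Ioc t s) (ω : Ω) :
    Tendsto (fun v => (A v).indicator (g v) ω) (𝓝[<] u) (𝓝 ((A u).indicator (g u) ω)) := by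
  by_cases hω : ω ∈ A u
  · rw [Set.indicator_of_mem hω]
    refine (hg.left u ω).congr' ?_
    filter_upwards [Ioo_mem_nhdsLT hu.1] with v hv
    rw [Set.indicator_of_mem (hA.anti v u hv.1.le hv.2.le hu.2 hω)]
  · rw [Set.indicator_of_notMem hω]
    have : ∃ v ∈ Set.Ico t u, ω ∉ A v := by
      by_contra! hcon
      exact hω (hA.left u hu ω hcon)
    obtain ⟨v, hv, hωv⟩ := this
    refine tendsto_nhds_of_eventually_eq ?_
    filter_upwards [Ioo_mem_nhdsLT hv.2] with w hw
    exact Set.indicator_of_notMem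
      (fun h => hωv (hA.anti v w hv.1 hw.1.le (hw.2.le.trans hu.2) h)) _

lemma IsLocalization.tendsto_riemannSum (hA : IsLocalization F t s A) (hts : t < s)
    (hg : IsRegularIntegrand F t s g) (ω : Ω) :
    Tendsto (fun m : ℕ => ∑ k ∈ Finset.range m,
      (A (gridPoint t s m k)).indicator (g (gridPoint t s m k)) ω *
        (gridPoint t s m (k + 1) - gridPoint t s m k)) atTop
      (𝓝 (∫ u in t..s, (A u).indicator (g u) ω)) := by
  obtain ⟨c, hc⟩ := hg.bounded
  refine tendsto_leftRiemannSum hts (f := fun u => (A u).indicator (g u) ω) (c := c)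
    (fun u => ?_) fun u hu => hA.tendsto_indicator hg hu ω
  by_cases hω : ω ∈ A u
  · simpa [Set.indicator_of_mem hω] using hc u ω
  · simpa [Set.indicator_of_notMem hω] using (abs_nonneg _).trans (hc u ω)

variable [mΩ : MeasurableSpace Ω]

lemma IsLocalization.measurable_riemannSum (hA : IsLocalization F t s A) (hts : t < s)
    (hF : ∀ u ∈ Set.Icc t s, F u ≤ mΩ)
    (hg : IsRegularIntegrand F t s g) (m : ℕ) :
    Measurable (fun ω => ∑ k ∈ Finset.range m,
      (A (gridPoint t s m k)).indicator (g (gridPoint t s m k)) ω *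
        (gridPoint t s m (k + 1) - gridPoint t s m k)) := by
  refine Finset.measurable_fun_sum _ fun k hk => ?_
  have hk' := Finset.mem_range.1 hk
  have hI := gridPoint_mem hts.le (by omega : 0 < m) hk'.le
  exact (((hg.measurable _ hI).indicator (hA.measurableSet _ hI)).mul_const _).mono (hF _ hI) le_rfl

/-- Measurability comes from the pointwise limit of Riemann sums, which avoids any joint
measurability in time and `ω`. -/
lemma IsLocalization.measurable_integral (hA : IsLocalization F t s A) (hts : t < s)
    (hF : ∀ u ∈ Set.Icc t s, F u ≤ mΩ) (hg : IsRegularIntegrand F t s g) :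
    Measurable (fun ω => ∫ u in t..s, (A u).indicator (g u) ω) :=
  measurable_of_tendsto_metrizable (hA.measurable_riemannSum hts hF hg)
    (tendsto_pi_nhds.2 fun ω => hA.tendsto_riemannSum hts hg ω)

variable {P : Measure Ω} {T : ℝ} {B : ℝ → Ω → ℝ}

open Classical in
/-- Localized energy estimate for a stochastic integral that is a limit of left Riemann sums. -/
lemma lintegral_localized_sq_le [IsProbabilityMeasure P] (hB : IsBrownianRelative P F t T B)
    (hts : t < s) (hsT : s ≤ T) (hA : IsLocalization F t s A) (hg : IsRegularIntegrand F t s g)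
    (hh : IsRegularIntegrand F t s h) {M : Ω → ℝ}
    (hM : ∀ᵐ ω ∂P, Tendsto (fun m : ℕ => ∑ k ∈ Finset.range m, g (gridPoint t s m k) ω *
      (B (gridPoint t s m (k + 1)) ω - B (gridPoint t s m k) ω)) atTop (𝓝 (M ω)))
    {ε : ℝ} (hε : 0 ≤ ε) :
    ∫⁻ ω, ENNReal.ofReal (if ω ∈ A s ∧
        ∫ u in t..s, (A u).indicator (fun ω => (g u ω - h u ω) ^ 2) ω < ε then M ω ^ 2 else 0) ∂P ≤
      ENNReal.ofReal (2 * ∫ ω, (∫ u in t..s, (A u).indicator (fun ω => h u ω ^ 2) ω) ∂P +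
        2 * ε) := by
  have hF : ∀ u ∈ Set.Icc t s, F u ≤ mΩ := fun u hu => hB.le u ⟨hu.1, hu.2.trans hsT⟩
  have hgh := (hg.sub hh).sq
  obtain ⟨c₁, hc₁⟩ := hg.bounded
  obtain ⟨c₂, hc₂⟩ := hh.bounded
  have hmem : ∀ m k, k ≤ m + 1 → gridPoint t s (m + 1) k ∈ Set.Icc t s := fun m k hk =>
    gridPoint_mem hts.le (Nat.succ_pos m) hk
  set S : ℕ → Ω → ℝ := fun m ω => ∑ k ∈ Finset.range m,
      (A (gridPoint t s m k)).indicator (fun ω => (g (gridPoint t s m k) ω -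
        h (gridPoint t s m k) ω) ^ 2) ω * (gridPoint t s m (k + 1) - gridPoint t s m k) with hS
  set V : ℕ → Ω → ℝ := fun m ω => ∑ k ∈ Finset.range m,
      (A (gridPoint t s m k)).indicator (fun ω => h (gridPoint t s m k) ω ^ 2) ω *
        (gridPoint t s m (k + 1) - gridPoint t s m k) with hV
  set R : ℕ → Ω → ℝ := fun m ω => ∑ k ∈ Finset.range m, g (gridPoint t s m k) ω *
      (B (gridPoint t s m (k + 1)) ω - B (gridPoint t s m k) ω) with hR
  have hSm : ∀ m, Measurable (S m) := hA.measurable_riemannSum hts hF hgh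
  have hVm : ∀ m, Measurable (V m) := hA.measurable_riemannSum hts hF hh.sq
  have hRm : ∀ m, Measurable (R (m + 1)) := fun m => by
    refine Finset.measurable_fun_sum _ fun k hk => ?_
    have hk' := Finset.mem_range.1 hk
    have h0 := hmem m k (by omega)
    have h1 := hmem m (k + 1) (by omega)
    exact ((hg.measurable _ h0).mono (hF _ h0) le_rfl).mul
      (((hB.adapted _ ⟨h1.1, h1.2.trans hsT⟩).mono (hF _ h1) le_rfl).sub
        ((hB.adapted _ ⟨h0.1, h0.2.trans hsT⟩).mono (hF _ h0) le_rfl))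
  have hs : s ∈ Set.Icc t s := ⟨hts.le, le_rfl⟩
  -- The index is shifted to `m + 1` because the grid with zero cells is constantly `t` and does not
  -- end at `s`.
  refine lintegral_le_of_ae_le_liminf
    (F := fun m ω => ENNReal.ofReal (if ω ∈ A s ∧ S (m + 1) ω ≤ ε then R (m + 1) ω ^ 2 else 0))
    (b := fun m => ENNReal.ofReal (2 * ∫ ω, V (m + 1) ω ∂P + 2 * ε)) ?_ ?_ ?_ ?_
  · intro m
    refine (ENNReal.measurable_ofReal.comp (Measurable.ite ?_ ((hRm m).pow_const 2)
      measurable_const)).aemeasurable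
    exact (hF s hs _ (hA.measurableSet s hs)).inter (hSm (m + 1) measurableSet_Iic)
  · filter_upwards [hM] with ω hω
    split_ifs with hcond
    · refine le_of_eq (Tendsto.liminf_eq ?_).symm
      -- The strict inequality for the integral passes to the Riemann sums eventually; this is why
      -- the limit statement has `< ε` where the discrete one has `≤ ε`.
      have h1 : ∀ᶠ m in atTop, S (m + 1) ω < ε :=
        ((tendsto_add_atTop_iff_nat 1).2 (hA.tendsto_riemannSum hts hgh ω)).eventually_lt_const
          hcond.2
      refine Tendsto.congr' (f₁ := fun m => ENNReal.ofReal (R (m + 1) ω ^ 2)) ?_ ?_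
      · filter_upwards [h1] with m hm
        rw [if_pos ⟨hcond.1, hm.le⟩]
      · exact (ENNReal.continuous_ofReal.tendsto _).comp
          (((tendsto_add_atTop_iff_nat 1).2 hω).pow 2)
    · simp
  · intro m
    have := integral_localized_sq_le hB (gridPoint_monotone hts.le (m + 1)) (n := m + 1)
      (fun k hk => ⟨(hmem m k hk).1, (hmem m k hk).2.trans hsT⟩)
      (g := fun k => g (gridPoint t s (m + 1) k)) (h := fun k => h (gridPoint t s (m + 1) k))
      (c := max c₁ c₂) (fun k hk => hg.measurable _ (hmem m k hk.le))
      (fun k ω => (hc₁ _ ω).trans (le_max_left _ _)) (fun k hk => hh.measurable _ (hmem m k hk.le))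
      (fun k ω => (hc₂ _ ω).trans (le_max_right _ _)) (E := fun k => A (gridPoint t s (m + 1) k))
      (fun k hk => hA.measurableSet _ (hmem m k hk.le))
      (fun k hk => hA.anti _ _ (hmem m k hk.le).1 (gridPoint_monotone hts.le _ hk.le)
        (hmem m _ le_rfl).2) hε
    simp only [gridPoint_self (Nat.succ_pos m)] at this
    exact this
  · refine (ENNReal.continuous_ofReal.tendsto _).comp (((Tendsto.const_mul 2 ?_)).add_const _)
    refine tendsto_integral_of_dominated_convergence (fun _ => c₂ ^ 2 * (s - t))
      (fun m => (hVm _).aestronglyMeasurable) (integrable_const _)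
      (fun m => ae_of_all _ fun ω => ?_)
      (ae_of_all _ fun ω => (tendsto_add_atTop_iff_nat 1).2 (hA.tendsto_riemannSum hts hh.sq ω))
    simp only [hV, gridPoint_succ_sub]
    have hδ : 0 ≤ (s - t) / ((m + 1 : ℕ) : ℝ) := div_nonneg (sub_nonneg.2 hts.le) (by positivity)
    have hle : ∀ u, |(A u).indicator (fun ω => h u ω ^ 2) ω| ≤ c₂ ^ 2 := fun u => by
      by_cases hω : ω ∈ A u
      · rw [Set.indicator_of_mem hω, abs_pow]
        exact pow_le_pow_left₀ (abs_nonneg _) (hc₂ u ω) 2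
      · rw [Set.indicator_of_notMem hω, abs_zero]; positivity
    calc _ ≤ ∑ k ∈ Finset.range (m + 1), c₂ ^ 2 * ((s - t) / ((m + 1 : ℕ) : ℝ)) := by
          refine (Finset.abs_sum_le_sum_abs _ _).trans (Finset.sum_le_sum fun k _ => ?_)
          rw [abs_mul, abs_of_nonneg hδ]
          exact mul_le_mul_of_nonneg_right (hle _) hδ
      _ = c₂ ^ 2 * (s - t) := by
          rw [Finset.sum_const, Finset.card_range, nsmul_eq_mul]
          field_simp

end ConstrainedSDE

/-! ### Passage from elementary integrals to Itô integrals. -/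

namespace ConstrainedSDE

variable {Ω : Type*} {F : ℝ → MeasurableSpace Ω} {t s T : ℝ} {A : ℝ → Set Ω} {g : ℝ → Ω → ℝ}

lemma IsLocalization.measurableSet_times (hA : IsLocalization F t s A) (ω : Ω) :
    MeasurableSet {u | u ∈ Set.Icc t s ∧ ω ∈ A u} := by
  refine Set.OrdConnected.measurableSet ⟨fun a ha b hb u hu => ?_⟩
  exact ⟨⟨ha.1.1.trans hu.1, hu.2.trans hb.1.2⟩,
    hA.anti u b (ha.1.1.trans hu.1) hu.2 hb.1.2 hb.2⟩

/-- Localizing an integrable path keeps it integrable. -/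
lemma IsLocalization.intervalIntegrable_indicator (hA : IsLocalization F t s A) (hts : t ≤ s)
    (ω : Ω) (hg : IntervalIntegrable (fun u => g u ω) volume t s) :
    IntervalIntegrable (fun u => (A u).indicator (g u) ω) volume t s := by
  rw [intervalIntegrable_iff_integrableOn_Icc_of_le hts] at hg ⊢
  refine (hg.indicator (hA.measurableSet_times ω)).congr ?_
  filter_upwards [ae_restrict_mem measurableSet_Icc] with u hu
  by_cases hω : ω ∈ A u
  · rw [Set.indicator_of_mem (show u ∈ {u | u ∈ Set.Icc t s ∧ ω ∈ A u} from ⟨hu, hω⟩),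
      Set.indicator_of_mem hω]
  · rw [Set.indicator_of_notMem (fun h : u ∈ {u | u ∈ Set.Icc t s ∧ ω ∈ A u} => hω h.2),
      Set.indicator_of_notMem hω]

/-- While the localization is alive, `|H| ≤ c` gives `|G - clip c G| ≤ |G - H|` and `|(clip c G)² -
H²| ≤ 2c |G - H|`. Cauchy–Schwarz in time then reduces the second limit to the mean-square
convergence. -/
lemma tendsto_localized_clip (hA : IsLocalization F t s A) (hts : t ≤ s) {ω : Ω} {c : ℝ}
    (hc : 0 ≤ c) {H : ℝ → Ω → ℝ} {G : ℕ → ℝ → Ω → ℝ}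
    (hH : MemLp (fun u => H u ω) 2 (volume.restrict (Set.Ioc t s)))
    (hG : ∀ n, MemLp (fun u => G n u ω) 2 (volume.restrict (Set.Ioc t s)))
    (hHc : ∀ u ∈ Set.Icc t s, ω ∈ A u → |H u ω| ≤ c)
    (hlim : Tendsto (fun n => ∫ u in t..s, (G n u ω - H u ω) ^ 2) atTop (𝓝 0)) :
    Tendsto (fun n => ∫ u in t..s, (A u).indicator (fun ω => (G n u ω - clip c (G n u ω)) ^ 2) ω)
      atTop (𝓝 0) ∧
    Tendsto (fun n => ∫ u in t..s, (A u).indicator (fun ω => clip c (G n u ω) ^ 2) ω) atTop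
      (𝓝 (∫ u in t..s, (A u).indicator (fun ω => H u ω ^ 2) ω)) := by
  have hGc : ∀ n, MemLp (fun u => clip c (G n u ω)) 2 (volume.restrict (Set.Ioc t s)) := fun n =>
    MemLp.of_bound ((continuous_clip c).comp_aestronglyMeasurable (hG n).1) c
      (ae_of_all _ fun u => abs_clip_le hc _)
  have ii : ∀ {f : ℝ → ℝ}, MemLp f 2 (volume.restrict (Set.Ioc t s)) →
      IntervalIntegrable (fun u => f u ^ 2) volume t s := fun hf =>
    (intervalIntegrable_iff_integrableOn_Ioc_of_le hts).2 hf.integrable_sq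
  have i1 : ∀ n, IntervalIntegrable (fun u => (G n u ω - H u ω) ^ 2) volume t s :=
    fun n => ii ((hG n).sub hH)
  constructor
  · refine squeeze_zero (fun n => ?_) (fun n => ?_) hlim
    · exact intervalIntegral.integral_nonneg hts fun u _ =>
        Set.indicator_nonneg (fun _ _ => sq_nonneg _) _
    · refine intervalIntegral.integral_mono_on hts
        (hA.intervalIntegrable_indicator hts ω (g := fun u ω => (G n u ω - clip c (G n u ω)) ^ 2)
          (ii ((hG n).sub (hGc n)))) (i1 n) fun u hu => ?_
      by_cases hω : ω ∈ A u
      · rw [Set.indicator_of_mem hω]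
        exact sq_le_sq.2 (abs_sub_clip_le (hHc u hu hω))
      · rw [Set.indicator_of_notMem hω]; positivity
  · have habs : ∀ n, IntervalIntegrable (fun u => |G n u ω - H u ω|) volume t s := fun n =>
      ((intervalIntegrable_iff_integrableOn_Ioc_of_le hts).2
        (((hG n).sub hH).integrable one_le_two)).abs
    have hj1 : ∀ n, IntervalIntegrable
        (fun u => (A u).indicator (fun ω => clip c (G n u ω) ^ 2) ω) volume t s := fun n =>
      hA.intervalIntegrable_indicator hts ω (g := fun u ω => clip c (G n u ω) ^ 2) (ii (hGc n))
    have hj2 : IntervalIntegrable (fun u => (A u).indicator (fun ω => H u ω ^ 2) ω) volume t s :=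
      hA.intervalIntegrable_indicator hts ω (g := fun u ω => H u ω ^ 2) (ii hH)
    rw [tendsto_iff_norm_sub_tendsto_zero]
    refine squeeze_zero (g := fun n => 2 * c * √((s - t) * ∫ u in t..s, (G n u ω - H u ω) ^ 2))
      (fun n => norm_nonneg _) (fun n => ?_) ?_
    · rw [← intervalIntegral.integral_sub (hj1 n) hj2]
      calc _ ≤ ∫ u in t..s, ‖(A u).indicator (fun ω => clip c (G n u ω) ^ 2) ω -
              (A u).indicator (fun ω => H u ω ^ 2) ω‖ :=
            intervalIntegral.norm_integral_le_integral_norm hts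
        _ ≤ ∫ u in t..s, 2 * c * |G n u ω - H u ω| := by
            refine intervalIntegral.integral_mono_on hts ((hj1 n).sub hj2).norm
              ((habs n).const_mul _) fun u hu => ?_
            by_cases hω : ω ∈ A u
            · simp only [Set.indicator_of_mem hω]
              have h1 := hHc u hu hω
              have h2 := abs_clip_le hc (G n u ω)
              have h3 := abs_clip_sub_clip_le c (G n u ω) (H u ω)
              rw [clip_of_abs_le h1] at h3
              rw [sq_sub_sq, norm_mul, Real.norm_eq_abs, Real.norm_eq_abs]
              refine mul_le_mul ((abs_add_le _ _).trans (by linarith)) h3 (abs_nonneg _)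
                (by linarith)
            · simp only [Set.indicator_of_notMem hω, sub_zero, norm_zero]
              positivity
        _ = 2 * c * ∫ u in t..s, |G n u ω - H u ω| := intervalIntegral.integral_const_mul _ _
        _ ≤ _ := by
            refine mul_le_mul_of_nonneg_left (Real.le_sqrt_of_sq_le ?_) (by linarith)
            have := sq_intervalIntegral_le hts (habs n) (by simpa only [sq_abs] using i1 n)
            simpa only [sq_abs] using this
    · have := (((hlim.const_mul (s - t)).sqrt).const_mul (2 * c))
      simpa using this

lemma ElementaryProcess.isRegularIntegrand (G : ElementaryProcess F t T)
    (hF : ∀ r u, t ≤ r → r ≤ u → u ≤ T → F r ≤ F u) (hsT : s ≤ T) :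
    IsRegularIntegrand F t s G.value where
  measurable _ hu := G.measurable_value hF ⟨hu.1, hu.2.trans hsT⟩
  bounded := G.exists_abs_value_le
  left u ω := G.tendsto_value_left ω u

variable [mΩ : MeasurableSpace Ω] {P : Measure Ω} {B : ℝ → Ω → ℝ}

/-- Localized energy estimate for limits of stochastic integrals. -/
lemma lintegral_localized_limit_sq_le [IsProbabilityMeasure P]
    (hB : IsBrownianRelative P F t T B) (hts : t < s) (hsT : s ≤ T) (hA : IsLocalization F t s A)
    {c : ℝ} (hc : 0 ≤ c) {H : ℝ → Ω → ℝ} {G : ℕ → ℝ → Ω → ℝ} {M : ℕ → Ω → ℝ} {J : Ω → ℝ}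
    (hG : ∀ n, IsRegularIntegrand F t s (G n)) (hGm : ∀ n ω, Measurable fun u => G n u ω)
    (hMm : ∀ n, Measurable (M n))
    (hM : ∀ n, ∀ᵐ ω ∂P, Tendsto (fun m : ℕ => ∑ k ∈ Finset.range m, G n (gridPoint t s m k) ω *
      (B (gridPoint t s m (k + 1)) ω - B (gridPoint t s m k) ω)) atTop (𝓝 (M n ω)))
    (hH : ∀ᵐ ω ∂P, MemLp (fun u => H u ω) 2 (volume.restrict (Set.Ioc t s)))
    (hHc : ∀ᵐ ω ∂P, ∀ u ∈ Set.Icc t s, ω ∈ A u → |H u ω| ≤ c)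
    (hlim : ∀ᵐ ω ∂P, Tendsto (fun n => ∫ u in t..s, (G n u ω - H u ω) ^ 2) atTop (𝓝 0))
    (hJ : ∀ᵐ ω ∂P, Tendsto (fun n => M n ω) atTop (𝓝 (J ω))) :
    ∫⁻ ω, ENNReal.ofReal ((A s).indicator (fun ω => J ω ^ 2) ω) ∂P ≤
      ENNReal.ofReal (2 * ∫ ω, (∫ u in t..s, (A u).indicator (fun ω => H u ω ^ 2) ω) ∂P) := by
  classical
  have hF : ∀ u ∈ Set.Icc t s, F u ≤ mΩ := fun u hu => hB.le u ⟨hu.1, hu.2.trans hsT⟩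
  have hs : s ∈ Set.Icc t s := ⟨hts.le, le_rfl⟩
  have hclip : ∀ᵐ ω ∂P,
      Tendsto (fun n => ∫ u in t..s, (A u).indicator (fun ω => (G n u ω - clip c (G n u ω)) ^ 2) ω)
        atTop (𝓝 0) ∧
      Tendsto (fun n => ∫ u in t..s, (A u).indicator (fun ω => clip c (G n u ω) ^ 2) ω) atTop
        (𝓝 (∫ u in t..s, (A u).indicator (fun ω => H u ω ^ 2) ω)) := by
    filter_upwards [hH, hHc, hlim] with ω h1 h2 h3
    refine tendsto_localized_clip hA hts.le hc h1 (fun n => ?_) h2 h3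
    obtain ⟨b, hb⟩ := (hG n).bounded
    exact MemLp.of_bound (hGm n ω).aestronglyMeasurable b (ae_of_all _ fun u => hb u ω)
  -- The comparison integrand is `clip c (G n)`: unlike `H`, it is known to be adapted and
  -- left-continuous. Its uniform bound `c` also allows dominated convergence of the expectations.
  -- Almost surely the cutoff condition holds for all large `n`, so Fatou's lemma recovers `J`.
  have hmain : ∀ ε : ℝ, 0 < ε → ∫⁻ ω, ENNReal.ofReal ((A s).indicator (fun ω => J ω ^ 2) ω) ∂P ≤
      ENNReal.ofReal (2 * ∫ ω, (∫ u in t..s, (A u).indicator (fun ω => H u ω ^ 2) ω) ∂P +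
        2 * ε) := by
    intro ε hε
    refine lintegral_le_of_ae_le_liminf
      (F := fun n ω => ENNReal.ofReal (if ω ∈ A s ∧ ∫ u in t..s, (A u).indicator
        (fun ω => (G n u ω - clip c (G n u ω)) ^ 2) ω < ε then M n ω ^ 2 else 0))
      (b := fun n => ENNReal.ofReal (2 * ∫ ω,
        (∫ u in t..s, (A u).indicator (fun ω => clip c (G n u ω) ^ 2) ω) ∂P + 2 * ε)) ?_ ?_ ?_ ?_
    · intro n
      refine (ENNReal.measurable_ofReal.comp (Measurable.ite ?_ ((hMm n).pow_const 2)
        measurable_const)).aemeasurable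
      exact (hF s hs _ (hA.measurableSet s hs)).inter
        (hA.measurable_integral hts hF ((hG n).sub ((hG n).clip hc)).sq measurableSet_Iio)
    · filter_upwards [hclip, hJ] with ω h1 h2
      by_cases hω : ω ∈ A s
      · rw [Set.indicator_of_mem hω]
        refine le_of_eq (Tendsto.liminf_eq ?_).symm
        refine Tendsto.congr' (f₁ := fun n => ENNReal.ofReal (M n ω ^ 2)) ?_
          ((ENNReal.continuous_ofReal.tendsto _).comp (h2.pow 2))
        filter_upwards [h1.1.eventually_lt_const hε] with n hn
        rw [if_pos ⟨hω, hn⟩]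
      · simp [Set.indicator_of_notMem hω]
    · intro n
      exact lintegral_localized_sq_le hB hts hsT hA (hG n) ((hG n).clip hc) (hM n) hε.le
    · refine (ENNReal.continuous_ofReal.tendsto _).comp (((Tendsto.const_mul 2 ?_)).add_const _)
      refine tendsto_integral_of_dominated_convergence (fun _ => c ^ 2 * |s - t|)
        (fun n => (hA.measurable_integral hts hF ((hG n).clip hc).sq).aestronglyMeasurable)
        (integrable_const _) (fun n => ae_of_all _ fun ω => ?_) (hclip.mono fun ω h => h.2)
      refine intervalIntegral.norm_integral_le_of_norm_le_const fun u _ => ?_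
      by_cases hω : ω ∈ A u
      · rw [Set.indicator_of_mem hω, norm_pow]
        exact pow_le_pow_left₀ (norm_nonneg _) (abs_clip_le hc _) 2
      · rw [Set.indicator_of_notMem hω, norm_zero]; positivity
  have hl : Tendsto (fun k : ℕ => ENNReal.ofReal
      (2 * ∫ ω, (∫ u in t..s, (A u).indicator (fun ω => H u ω ^ 2) ω) ∂P +
        2 * (1 / ((k : ℝ) + 1)))) atTop
      (𝓝 (ENNReal.ofReal
        (2 * ∫ ω, (∫ u in t..s, (A u).indicator (fun ω => H u ω ^ 2) ω) ∂P))) := by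
    refine (ENNReal.continuous_ofReal.tendsto _).comp ?_
    simpa using (tendsto_one_div_add_atTop_nhds_zero_nat.const_mul (2 : ℝ)).const_add
      (2 * ∫ ω, (∫ u in t..s, (A u).indicator (fun ω => H u ω ^ 2) ω) ∂P)
  exact ge_of_tendsto' hl fun k => hmain _ (by positivity)

lemma ElementaryProcess.measurable_integral (G : ElementaryProcess F t T)
    (hF : ∀ r ∈ Set.Icc t T, F r ≤ mΩ) (hB : ∀ r ∈ Set.Icc t T, Measurable[F r] (B r))
    (hs : s ∈ Set.Icc t T) : Measurable (G.integral B s) := by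
  have h : ∀ k, Measurable (B (min (G.τ k) s)) := fun k => by
    have : min (G.τ k) s ∈ Set.Icc t T :=
      ⟨le_min (G.time_mem k).1 hs.1, (min_le_right _ _).trans hs.2⟩
    exact (hB _ this).mono (hF _ this) le_rfl
  exact Finset.measurable_fun_sum _ fun k _ =>
    ((G.measurable_height k).mono (hF _ (G.time_mem k)) le_rfl).mul ((h _).sub (h _))

/-- Localized Itô estimate for the difference of two Itô integrals. -/
lemma lintegral_localized_itoIntegral_sub_sq_le [IsProbabilityMeasure P]
    (hB : IsBrownianRelative P F t T B) (hts : t < s) (hsT : s ≤ T) (hA : IsLocalization F t s A)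
    {c : ℝ} (hc : 0 ≤ c) {H H' I I' : ℝ → Ω → ℝ} (hI : IsItoIntegral P F t T B H I)
    (hI' : IsItoIntegral P F t T B H' I')
    (hHc : ∀ᵐ ω ∂P, ∀ u ∈ Set.Icc t s, ω ∈ A u → |H u ω - H' u ω| ≤ c) :
    ∫⁻ ω, ENNReal.ofReal ((A s).indicator (fun ω => (I s ω - I' s ω) ^ 2) ω) ∂P ≤
      ENNReal.ofReal (2 * ∫ ω,
        (∫ u in t..s, (A u).indicator (fun ω => (H u ω - H' u ω) ^ 2) ω) ∂P) := by
  have hs : s ∈ Set.Icc t T := ⟨hts.le, hsT⟩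
  obtain ⟨G, hG1, hG2⟩ := hI.approx
  obtain ⟨G', hG1', hG2'⟩ := hI'.approx
  -- Four successive extractions turn all the limits in probability into almost sure limits along
  -- one subsequence.
  obtain ⟨n₁, hn₁, h₁⟩ := hG1.exists_seq_tendsto_ae
  obtain ⟨n₂, hn₂, h₂⟩ := ((hG2 s hs).comp hn₁.tendsto_atTop).exists_seq_tendsto_ae
  obtain ⟨n₃, hn₃, h₃⟩ :=
    ((hG1'.comp hn₁.tendsto_atTop).comp hn₂.tendsto_atTop).exists_seq_tendsto_ae
  obtain ⟨n₄, hn₄, h₄⟩ := ((((hG2' s hs).comp hn₁.tendsto_atTop).comp hn₂.tendsto_atTop).comp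
    hn₃.tendsto_atTop).exists_seq_tendsto_ae
  set N : ℕ → ℕ := fun k => n₁ (n₂ (n₃ (n₄ k))) with hN
  have hsub : Set.Ioc t s ⊆ Set.Icc t T := fun u hu => ⟨hu.1.le, hu.2.trans hsT⟩
  refine lintegral_localized_limit_sq_le hB hts hsT hA hc
    (G := fun k u ω => (G (N k)).value u ω - (G' (N k)).value u ω)
    (M := fun k ω => (G (N k)).integral B s ω - (G' (N k)).integral B s ω)
    (fun k => ((G _).isRegularIntegrand hB.mono hsT).sub ((G' _).isRegularIntegrand hB.mono hsT))
    (fun k ω => ((G _).measurable_value_time ω).sub ((G' _).measurable_value_time ω))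
    (fun k => ((G _).measurable_integral hB.le hB.adapted hs).sub
      ((G' _).measurable_integral hB.le hB.adapted hs)) ?_ ?_ hHc ?_ ?_
  · intro k
    filter_upwards [hB.continuous] with ω hω
    refine (((G (N k)).tendsto_sum_value_mul_increment hts hsT hω).sub
      ((G' (N k)).tendsto_sum_value_mul_increment hts hsT hω)).congr fun m => ?_
    simp only [sub_mul, Finset.sum_sub_distrib]
  · filter_upwards [hI.memLp, hI'.memLp] with ω h1 h2
    exact (h1.sub h2).mono_measure (Measure.restrict_mono hsub le_rfl)
  · filter_upwards [hI.memLp, hI'.memLp, h₁, h₃] with ω m1 m2 l1 l2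
    have hval : ∀ G : ElementaryProcess F t T,
        MemLp (fun u => G.value u ω) 2 (volume.restrict (Set.Icc t T)) := fun G => by
      obtain ⟨b, hb⟩ := G.exists_abs_value_le
      exact MemLp.of_bound (G.measurable_value_time ω).aestronglyMeasurable b
        (ae_of_all _ fun u => hb u ω)
    have l1' := l1.comp (hn₂.tendsto_atTop.comp (hn₃.tendsto_atTop.comp hn₄.tendsto_atTop))
    have l2' := l2.comp hn₄.tendsto_atTop
    have hl := (l1'.const_mul 2).add (l2'.const_mul 2)
    simp only [mul_zero, add_zero] at hl
    refine squeeze_zero (fun k => intervalIntegral.integral_nonneg hts.le fun u _ => sq_nonneg _)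
      (fun k => ?_) hl
    have i1 : IntegrableOn (fun u => ((G (N k)).value u ω - H u ω) ^ 2) (Set.Icc t T) :=
      ((hval (G (N k))).sub m1).integrable_sq
    have i2 : IntegrableOn (fun u => ((G' (N k)).value u ω - H' u ω) ^ 2) (Set.Icc t T) :=
      ((hval (G' (N k))).sub m2).integrable_sq
    have i3 : IntegrableOn (fun u => (((G (N k)).value u ω - (G' (N k)).value u ω) -
        (H u ω - H' u ω)) ^ 2) (Set.Icc t T) :=
      (((hval (G (N k))).sub (hval (G' (N k)))).sub (m1.sub m2)).integrable_sq
    rw [intervalIntegral.integral_of_le hts.le]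
    calc _ ≤ ∫ u in Set.Icc t T, (((G (N k)).value u ω - (G' (N k)).value u ω) -
            (H u ω - H' u ω)) ^ 2 :=
          setIntegral_mono_set i3 (ae_of_all _ fun u => sq_nonneg _) hsub.eventuallyLE
      _ ≤ ∫ u in Set.Icc t T, (2 * ((G (N k)).value u ω - H u ω) ^ 2 +
            2 * ((G' (N k)).value u ω - H' u ω) ^ 2) := by
          refine integral_mono i3 ((i1.const_mul 2).add (i2.const_mul 2)) fun u => ?_
          dsimp only
          nlinarith [sq_nonneg (((G (N k)).value u ω - H u ω) + ((G' (N k)).value u ω - H' u ω))]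
      _ = _ := by
          rw [integral_add (i1.const_mul 2) (i2.const_mul 2), integral_const_mul,
            integral_const_mul]
          rfl
  · filter_upwards [h₂, h₄] with ω l1 l2
    exact (l1.comp (hn₃.tendsto_atTop.comp hn₄.tendsto_atTop)).sub l2

end ConstrainedSDE

namespace ConstrainedSDE

/-! ### Uniform Lipschitz bounds on compact parts of the allowed region. -/

section Coefficients

variable {d d' : ℕ}

/-- Compactness yields a bound `M`, a scale `δ` and a Lipschitz constant valid for pairs closer than
`δ`. For more distant pairs the bound alone gives the constant `2M/δ`, so no convexity of `K` is
needed. -/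
lemma exists_bound_lipschitz_of_isCompact {a : ℝ × Space d → Space d'} {S K : Set (ℝ × Space d)}
    (hK : IsCompact K) (hKS : K ⊆ S) (hlip : LocallyLipschitzInSpaceOn a S)
    (hbdd : LocallyBoundedOn a S) :
    ∃ L : ℝ, 0 ≤ L ∧ (∀ p ∈ K, ‖a p‖ ≤ L) ∧
      ∀ s x y, (s, x) ∈ K → (s, y) ∈ K → ‖a (s, x) - a (s, y)‖ ≤ L * ‖x - y‖ := by
  obtain ⟨M, hM⟩ : ∃ M : ℝ, ∀ p ∈ K, ‖a p‖ ≤ M := by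
    refine hK.induction_on (p := fun V => ∃ M : ℝ, ∀ p ∈ V, ‖a p‖ ≤ M) ⟨0, by simp⟩ ?_ ?_ ?_
    · rintro V V' hV ⟨M, hM⟩
      exact ⟨M, fun p hp => hM p (hV hp)⟩
    · rintro V V' ⟨M, hM⟩ ⟨M', hM'⟩
      refine ⟨max M M', fun p hp => ?_⟩
      rcases hp with hp | hp
      exacts [(hM p hp).trans (le_max_left _ _), (hM' p hp).trans (le_max_right _ _)]
    · intro p hp
      obtain ⟨U, hU, M, hM⟩ := hbdd p (hKS hp)
      exact ⟨U, nhdsWithin_mono p hKS hU, M, hM⟩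
  -- Only the first point is tied to the member of the cover, which makes the property stable under
  -- unions.
  obtain ⟨δ, hδ, L, hL⟩ : ∃ δ : ℝ, 0 < δ ∧ ∃ L : ℝ, ∀ s x y, (s, x) ∈ K → (s, y) ∈ S →
      ‖x - y‖ < δ → ‖a (s, x) - a (s, y)‖ ≤ L * ‖x - y‖ := by
    refine hK.induction_on (p := fun V => ∃ δ : ℝ, 0 < δ ∧ ∃ L : ℝ, ∀ s x y, (s, x) ∈ V →
      (s, y) ∈ S → ‖x - y‖ < δ → ‖a (s, x) - a (s, y)‖ ≤ L * ‖x - y‖) ⟨1, one_pos, 0, by simp⟩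
      ?_ ?_ ?_
    · rintro V V' hV ⟨δ, hδ, L, hL⟩
      exact ⟨δ, hδ, L, fun s x y hx => hL s x y (hV hx)⟩
    · rintro V V' ⟨δ, hδ, L, hL⟩ ⟨δ', hδ', L', hL'⟩
      refine ⟨min δ δ', lt_min hδ hδ', max L L', fun s x y hx hy hxy => ?_⟩
      rcases hx with hx | hx
      · exact (hL s x y hx hy (hxy.trans_le (min_le_left _ _))).trans
          (mul_le_mul_of_nonneg_right (le_max_left _ _) (norm_nonneg _))
      · exact (hL' s x y hx hy (hxy.trans_le (min_le_right _ _))).trans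
          (mul_le_mul_of_nonneg_right (le_max_right _ _) (norm_nonneg _))
    · intro p hp
      obtain ⟨U, hU, L, hL⟩ := hlip p (hKS hp)
      obtain ⟨ε, hε, hball⟩ := Metric.mem_nhdsWithin_iff.1 hU
      refine ⟨Metric.ball p (ε / 2) ∩ K,
        inter_mem (mem_nhdsWithin_of_mem_nhds (Metric.ball_mem_nhds p (half_pos hε)))
          self_mem_nhdsWithin, ε / 2, half_pos hε, L, fun s x y hx hy hxy => ?_⟩
      refine hL s x y (hball ⟨?_, hKS hx.2⟩) (hball ⟨?_, hy⟩)
      · exact Metric.ball_subset_ball (by linarith) hx.1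
      · have h1 : dist ((s, y) : ℝ × Space d) (s, x) < ε / 2 := by
          rw [dist_prod_same_left, dist_comm, dist_eq_norm]; exact hxy
        have h2 : dist ((s, x) : ℝ × Space d) p < ε / 2 := hx.1
        exact Metric.mem_ball.2 ((dist_triangle _ (s, x) _).trans_lt (by linarith))
  refine ⟨max (max L (2 * M / δ)) (max M 0), le_max_of_le_right (le_max_right _ _),
    fun p hp => (hM p hp).trans (le_max_of_le_right (le_max_left _ _)), fun s x y hx hy => ?_⟩
  rcases lt_or_ge ‖x - y‖ δ with h | h
  · refine (hL s x y hx (hKS hy) h).trans ?_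
    gcongr
    exact le_max_of_le_left (le_max_left _ _)
  · have h1 := (norm_sub_le _ _).trans (add_le_add (hM _ hx) (hM _ hy))
    have hM0 : 0 ≤ M := (norm_nonneg _).trans (hM _ hx)
    calc ‖a (s, x) - a (s, y)‖ ≤ 2 * M / δ * δ := by
          rw [div_mul_cancel₀ _ hδ.ne']; linarith
      _ ≤ 2 * M / δ * ‖x - y‖ := by gcongr
      _ ≤ _ := by
          gcongr
          exact le_max_of_le_left (le_max_right _ _)

lemma abs_apply_le_matNorm (M : Matrix (Fin d) (Fin d') ℝ) (i : Fin d) (j : Fin d') :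
    |M i j| ≤ matNorm M := by
  rw [matNorm]
  refine Real.abs_le_sqrt ?_
  calc M i j ^ 2 ≤ ∑ j, M i j ^ 2 :=
        Finset.single_le_sum (f := fun j => M i j ^ 2) (fun _ _ => sq_nonneg _) (Finset.mem_univ j)
    _ ≤ ∑ i, ∑ j, M i j ^ 2 :=
        Finset.single_le_sum (f := fun i => ∑ j, M i j ^ 2)
          (fun _ _ => Finset.sum_nonneg fun _ _ => sq_nonneg _) (Finset.mem_univ i)

lemma norm_mulVec_le (M : Matrix (Fin d) (Fin d') ℝ) (v : Space d') :
    ‖(WithLp.toLp 2 (M.mulVec v.ofLp) : Space d)‖ ≤ matNorm M * ‖v‖ := by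
  have hM : matNorm M ^ 2 = ∑ i, ∑ j, M i j ^ 2 :=
    Real.sq_sqrt (Finset.sum_nonneg fun _ _ => Finset.sum_nonneg fun _ _ => sq_nonneg _)
  have hM0 : 0 ≤ matNorm M := Real.sqrt_nonneg _
  refine (sq_le_sq₀ (norm_nonneg _) (mul_nonneg hM0 (norm_nonneg _))).1 ?_
  rw [mul_pow, hM, EuclideanSpace.real_norm_sq_eq, EuclideanSpace.real_norm_sq_eq, Finset.sum_mul]
  refine Finset.sum_le_sum fun i _ => ?_
  exact Finset.sum_mul_sq_le_sq_mul_sq Finset.univ (fun j => M i j) fun j => v.ofLp j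

/-- The part of the allowed region at distance at least `1/(n+1)` from the constraint and from the
terminal time, within the ball of radius `n`. -/
def innerRegion (T : ℝ) (D : Set (ℝ × Space d)) (n : ℕ) : Set (ℝ × Space d) :=
  {p | 0 ≤ p.1 ∧ p.1 ≤ T - 1 / ((n : ℝ) + 1) ∧ ‖p‖ ≤ n ∧ ∀ q ∈ D, 1 / ((n : ℝ) + 1) ≤ dist p q}

variable {T : ℝ} {D : Set (ℝ × Space d)}

lemma isCompact_innerRegion (n : ℕ) : IsCompact (innerRegion T D n) := by
  have heq : innerRegion T D n = {p | 0 ≤ p.1} ∩ ({p | p.1 ≤ T - 1 / ((n : ℝ) + 1)} ∩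
      ({p | ‖p‖ ≤ n} ∩ ⋂ q ∈ D, {p | 1 / ((n : ℝ) + 1) ≤ dist p q})) := by
    ext p
    simp [innerRegion]
  have hclosed : IsClosed (innerRegion T D n) := by
    rw [heq]
    exact (isClosed_le continuous_const continuous_fst).inter
      ((isClosed_le continuous_fst continuous_const).inter
        ((isClosed_le continuous_norm continuous_const).inter
          (isClosed_biInter fun q _ => isClosed_le continuous_const
            (continuous_id.dist continuous_const))))
  exact (isCompact_closedBall (0 : ℝ × Space d) n).of_isClosed_subset hclosed
    fun p hp => by simpa using hp.2.2.1

lemma innerRegion_subset (n : ℕ) : innerRegion T D n ⊆ allowedBefore T D := by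
  intro p hp
  have hn : 0 < 1 / ((n : ℝ) + 1) := by positivity
  refine ⟨⟨⟨hp.1, hp.2.1.trans (by linarith)⟩, fun hpD => ?_⟩, hp.2.1.trans_lt (by linarith)⟩
  have := hp.2.2.2 p hpD
  rw [dist_self] at this
  linarith

/-- A compact set is bounded and, by closedness of `D`, keeps a positive distance from the
constraint as well as from time `T`. -/
lemma exists_subset_innerRegion (hD : IsClosed D) {S : Set (ℝ × Space d)} (hS : IsCompact S)
    (hSA : S ⊆ allowedBefore T D) : ∃ n, S ⊆ innerRegion T D n := by
  obtain ⟨T', hT', hST'⟩ : ∃ δ > 0, ∀ p ∈ S, δ ≤ T - p.1 :=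
    hS.exists_forall_le' (f := fun p => T - p.1) (by fun_prop)
      fun p hp => sub_pos.2 (hSA hp).2
  obtain ⟨δ, hδ, hSδ⟩ := hS.exists_thickening_subset_open hD.isOpen_compl
    fun p hp => (hSA hp).1.2
  obtain ⟨R, hR⟩ := hS.isBounded.exists_norm_le
  obtain ⟨n₁, hn₁⟩ := exists_nat_one_div_lt (lt_min hT' hδ)
  obtain ⟨n₂, hn₂⟩ := exists_nat_ge R
  refine ⟨max n₁ n₂, fun p hp => ?_⟩
  have h1 : 1 / (((max n₁ n₂ : ℕ) : ℝ) + 1) ≤ min T' δ := by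
    refine le_trans ?_ hn₁.le
    gcongr
    exact le_max_left _ _
  have h2 : (n₂ : ℝ) ≤ ((max n₁ n₂ : ℕ) : ℝ) := by exact_mod_cast le_max_right _ _
  refine ⟨(hSA hp).1.1.1, ?_, (hR p hp).trans (hn₂.trans h2), fun q hq => ?_⟩
  · have := hST' p hp
    have := h1.trans (min_le_left _ _)
    linarith
  · refine (h1.trans (min_le_right _ _)).trans ?_
    by_contra! hlt
    exact hSδ (Metric.mem_thickening_iff.2 ⟨p, hp, by rwa [dist_comm]⟩) hq

/-- On each inner region the drift `μ + σ α` and the diffusion are Lipschitz in space. -/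
lemma exists_lipschitz_innerRegion {μ : ℝ × Space d → Space d}
    {σ : ℝ × Space d → Matrix (Fin d) (Fin d') ℝ} (hμσ : IsCoefficientPair T μ σ)
    {α : ℝ × Space d → Space d'} (hα_lip : LocallyLipschitzInSpaceOn α (allowedBefore T D))
    (hα_bdd : LocallyBoundedOn α (allowedBefore T D)) (n : ℕ) :
    ∃ L : ℝ, 0 ≤ L ∧ ∀ s x y, (s, x) ∈ innerRegion T D n → (s, y) ∈ innerRegion T D n →
      ‖controlledDrift μ σ α (s, x) - controlledDrift μ σ α (s, y)‖ ≤ L * ‖x - y‖ ∧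
      ∀ i j, |σ (s, x) i j - σ (s, y) i j| ≤ L * ‖x - y‖ := by
  obtain ⟨La, hLa, hab, hal⟩ := exists_bound_lipschitz_of_isCompact (isCompact_innerRegion n)
    (innerRegion_subset n) hα_lip hα_bdd
  obtain ⟨L, hL⟩ := hμσ.locallyLipschitz n
  obtain ⟨K, hK⟩ := hμσ.linearGrowth
  have hKn : 0 ≤ |K| * (1 + n) := by positivity
  -- The three terms bound the increments of `μ`, of `σ` with `α` frozen, and of `α` with `σ`
  -- frozen. On the ball of radius `n`, linear growth bounds `σ` by `|K| (1 + n)`.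
  refine ⟨|L| + |L| * La + |K| * (1 + n) * La, by positivity, fun s x y hx hy => ?_⟩
  have hsT : s ≤ T := (innerRegion_subset n hx).2.le
  have hxn : ‖x‖ ≤ n := (norm_snd_le (s, x)).trans hx.2.2.1
  have hyn : ‖y‖ ≤ n := (norm_snd_le (s, y)).trans hy.2.2.1
  obtain ⟨hμ, hσ⟩ := hL s hx.1 hsT x y hxn hyn
  have hLL : L * ‖x - y‖ ≤ |L| * ‖x - y‖ := by gcongr; exact le_abs_self L
  have hσy : matNorm (σ (s, y)) ≤ |K| * (1 + n) := by
    refine (hK s hx.1 hsT y).2.trans ?_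
    calc K * (1 + ‖y‖) ≤ |K| * (1 + ‖y‖) := by gcongr; exact le_abs_self K
      _ ≤ |K| * (1 + n) := by gcongr
  have hxy := norm_nonneg (x - y)
  constructor
  · have hsplit : controlledDrift μ σ α (s, x) - controlledDrift μ σ α (s, y) =
        (μ (s, x) - μ (s, y)) +
          (WithLp.toLp 2 ((σ (s, x) - σ (s, y)).mulVec (α (s, x)).ofLp) +
            WithLp.toLp 2 ((σ (s, y)).mulVec (α (s, x) - α (s, y)).ofLp)) := by
      simp only [controlledDrift, Matrix.sub_mulVec, WithLp.ofLp_sub, Matrix.mulVec_sub,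
        WithLp.toLp_sub]
      abel
    rw [hsplit]
    have h1 := (norm_mulVec_le (σ (s, x) - σ (s, y)) (α (s, x))).trans
      (mul_le_mul (hσ.trans hLL) (hab _ hx) (norm_nonneg _) (by positivity))
    have h2 := (norm_mulVec_le (σ (s, y)) (α (s, x) - α (s, y))).trans
      (mul_le_mul hσy (hal s x y hx hy) (norm_nonneg _) hKn)
    refine (norm_add_le _ _).trans ((add_le_add (hμ.trans hLL)
      ((norm_add_le _ _).trans (add_le_add h1 h2))).trans (le_of_eq ?_))
    ring
  · intro i j
    refine (abs_apply_le_matNorm (σ (s, x) - σ (s, y)) i j).trans ((hσ.trans hLL).trans ?_)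
    have : 0 ≤ (|L| * La + |K| * (1 + n) * La) * ‖x - y‖ := by positivity
    nlinarith

end Coefficients

/-- Grönwall's lemma for the homogeneous integral inequality, without regularity assumptions. -/
lemma eq_zero_of_le_lintegral {t T C M : ℝ} (hC : 0 ≤ C) (hM : 0 ≤ M) {φ : ℝ → ENNReal}
    (hφM : ∀ s ∈ Set.Ioc t T, φ s ≤ ENNReal.ofReal M)
    (hφ : ∀ s ∈ Set.Ioc t T, φ s ≤ ENNReal.ofReal C * ∫⁻ u in Set.Ioc t s, φ u) :
    ∀ s ∈ Set.Ioc t T, φ s = 0 := by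
  -- Iterating the inequality from the constant bound `M` produces the terms of an exponential
  -- series, which tend to zero.
  have key : ∀ k : ℕ, ∀ s ∈ Set.Ioc t T,
      φ s ≤ ENNReal.ofReal (M * ((C * (s - t)) ^ k / k.factorial)) := by
    intro k
    induction k with
    | zero => simpa using hφM
    | succ k ih =>
      intro s hs
      have hpow : ∫ u in t..s, M * ((C * (u - t)) ^ k / k.factorial) =
          M * (C ^ k * (s - t) ^ (k + 1) / (k + 1).factorial) := by
        have e : ∀ u : ℝ, M * ((C * (u - t)) ^ k / k.factorial) =
            M * C ^ k / k.factorial * (u - t) ^ k := fun u => by rw [mul_pow]; ring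
        simp only [e]
        rw [intervalIntegral.integral_const_mul,
          intervalIntegral.integral_comp_sub_right (fun u => u ^ k) t, integral_pow,
          Nat.factorial_succ]
        have : (k.factorial : ℝ) ≠ 0 := by positivity
        push_cast
        simp
        field_simp
      calc φ s ≤ ENNReal.ofReal C * ∫⁻ u in Set.Ioc t s, φ u := hφ s hs
        _ ≤ ENNReal.ofReal C * ∫⁻ u in Set.Ioc t s,
              ENNReal.ofReal (M * ((C * (u - t)) ^ k / k.factorial)) := by
            gcongr ENNReal.ofReal C * ?_
            exact setLIntegral_mono' measurableSet_Ioc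
              fun u hu => ih u ⟨hu.1, hu.2.trans hs.2⟩
        _ = ENNReal.ofReal C * ENNReal.ofReal
              (∫ u in t..s, M * ((C * (u - t)) ^ k / k.factorial)) := by
            rw [intervalIntegral.integral_of_le hs.1.le, ofReal_integral_eq_lintegral_ofReal]
            · exact (Continuous.integrableOn_Ioc (by fun_prop))
            · filter_upwards [ae_restrict_mem measurableSet_Ioc] with u hu
              have : 0 ≤ u - t := sub_nonneg.2 hu.1.le
              show 0 ≤ M * ((C * (u - t)) ^ k / k.factorial)
              positivity
        _ = _ := by
            rw [hpow, ← ENNReal.ofReal_mul hC]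
            congr 1
            rw [mul_pow]
            ring
  intro s hs
  have hlim : Tendsto (fun k : ℕ => ENNReal.ofReal (M * ((C * (s - t)) ^ k / k.factorial))) atTop
      (𝓝 0) := by
    have := ((FloorSemiring.tendsto_pow_div_factorial_atTop (C * (s - t))).const_mul M)
    rw [mul_zero] at this
    simpa [Function.comp_def] using (ENNReal.continuous_ofReal.tendsto 0).comp this
  exact le_antisymm (ge_of_tendsto' hlim fun k => key k s hs) bot_le

end ConstrainedSDE

namespace ConstrainedSDE

/-! ### Events that a path stays in a closed set, and continuous versions. -/

section Localization

variable {Ω : Type*} {F : ℝ → MeasurableSpace Ω} {t T : ℝ} {d : ℕ}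

/-- The point of `[t,u]` closest to `q`. -/
def clampTime (t u q : ℝ) : ℝ := max t (min u q)

lemma clampTime_mem {u : ℝ} (htu : t ≤ u) (q : ℝ) : clampTime t u q ∈ Set.Icc t u :=
  ⟨le_max_left _ _, max_le htu (min_le_left _ _)⟩

lemma clampTime_of_mem {u q : ℝ} (hq : q ∈ Set.Icc t u) : clampTime t u q = q := by
  rw [clampTime, min_eq_right hq.2, max_eq_right hq.1]

lemma continuous_clampTime : Continuous fun p : ℝ × ℝ => clampTime t p.1 p.2 := by
  unfold clampTime; fun_prop

/-- The event that the time-space path of `Y` lies in `K` up to time `u`. -/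
def stayUntil (K : Set (ℝ × Space d)) (t : ℝ) (Y : ℝ → Ω → Space d) (u : ℝ) : Set Ω :=
  {ω | ∀ q : ℚ, (clampTime t u q, Y (clampTime t u q) ω) ∈ K}

variable {K : Set (ℝ × Space d)} {Y : ℝ → Ω → Space d}

/-- Clamped rationals are dense in `[t,u]`, so for a closed set and a continuous path countably many
conditions suffice. This makes the event measurable at time `u`. -/
lemma mem_stayUntil_iff (hK : IsClosed K) {ω : Ω} (hY : Continuous fun r => Y r ω) {u : ℝ}
    (htu : t ≤ u) : ω ∈ stayUntil K t Y u ↔ ∀ r ∈ Set.Icc t u, (r, Y r ω) ∈ K := by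
  refine ⟨fun h r hr => ?_, fun h q => h _ (clampTime_mem htu q)⟩
  have hc : Continuous fun q : ℝ => clampTime t u q :=
    continuous_clampTime.comp (Continuous.prodMk_right u)
  have hcl : IsClosed {q : ℝ | (clampTime t u q, Y (clampTime t u q) ω) ∈ K} :=
    hK.preimage (hc.prodMk (hY.comp hc))
  have hsub : Set.range ((↑) : ℚ → ℝ) ⊆
      {q : ℝ | (clampTime t u q, Y (clampTime t u q) ω) ∈ K} := by
    rintro _ ⟨q, rfl⟩
    exact h q
  have : r ∈ {q : ℝ | (clampTime t u q, Y (clampTime t u q) ω) ∈ K} :=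
    closure_minimal hsub hcl (Rat.denseRange_cast r)
  simpa only [Set.mem_ofPred_eq, clampTime_of_mem hr] using this

lemma isLocalization_stayUntil (hK : IsClosed K) (hY : ∀ ω, Continuous fun r => Y r ω)
    (hF : ∀ r u, t ≤ r → r ≤ u → u ≤ T → F r ≤ F u)
    (hYm : ∀ u ∈ Set.Icc t T, Measurable[F u] (Y u)) :
    IsLocalization F t T (stayUntil K t Y) where
  measurableSet u hu := by
    have : stayUntil K t Y u =
        ⋂ q : ℚ, {ω | (clampTime t u q, Y (clampTime t u q) ω) ∈ K} := by
      ext ω; simp [stayUntil]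
    rw [this]
    refine MeasurableSet.iInter fun q => ?_
    have hr := clampTime_mem hu.1 (q : ℝ)
    have hm : Measurable[F u] (Y (clampTime t u q)) :=
      (hYm _ ⟨hr.1, hr.2.trans hu.2⟩).mono (hF _ _ hr.1 hr.2 hu.2) le_rfl
    exact (measurable_const.prodMk hm) hK.measurableSet
  anti u v htu huv _ ω hω := by
    rw [mem_stayUntil_iff hK (hY ω) htu]
    rw [mem_stayUntil_iff hK (hY ω) (htu.trans huv)] at hω
    exact fun r hr => hω r ⟨hr.1, hr.2.trans huv⟩
  left u hu ω h := by
    rw [mem_stayUntil_iff hK (hY ω) hu.1.le]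
    -- Staying in a closed set on `[t,u)` forces membership at `u`; this is the left-continuity of
    -- the localization.
    have hcl : IsClosed {r : ℝ | (r, Y r ω) ∈ K} := hK.preimage (continuous_id.prodMk (hY ω))
    have hsub : Set.Ico t u ⊆ {r : ℝ | (r, Y r ω) ∈ K} := fun r hr =>
      (mem_stayUntil_iff hK (hY ω) hr.1).1 (h r hr) r ⟨hr.1, le_rfl⟩
    intro r hr
    rw [← closure_Ico hu.1.ne] at hr
    exact closure_minimal hsub hcl hr

lemma IsLocalization.inter {A A' : ℝ → Set Ω} (hA : IsLocalization F t T A)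
    (hA' : IsLocalization F t T A') : IsLocalization F t T (fun u => A u ∩ A' u) where
  measurableSet u hu := (hA.measurableSet u hu).inter (hA'.measurableSet u hu)
  anti u v h1 h2 h3 := Set.inter_subset_inter (hA.anti u v h1 h2 h3) (hA'.anti u v h1 h2 h3)
  left u hu ω h := ⟨hA.left u hu ω fun v hv => (h v hv).1, hA'.left u hu ω fun v hv => (h v hv).2⟩

lemma IsLocalization.restrict {A : ℝ → Set Ω} (hA : IsLocalization F t T A) {s : ℝ} (hs : s ≤ T) :
    IsLocalization F t s A where
  measurableSet u hu := hA.measurableSet u ⟨hu.1, hu.2.trans hs⟩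
  anti u v h1 h2 h3 := hA.anti u v h1 h2 (h3.trans hs)
  left u hu := hA.left u ⟨hu.1, hu.2.trans hs⟩

variable [mΩ : MeasurableSpace Ω]

lemma measurableSet_prod_stayUntil (hK : IsClosed K) (hY : ∀ ω, Continuous fun r => Y r ω)
    (hYm : ∀ u, Measurable (Y u)) :
    MeasurableSet {p : ℝ × Ω | p.2 ∈ stayUntil K t Y p.1} := by
  have : {p : ℝ × Ω | p.2 ∈ stayUntil K t Y p.1} =
      ⋂ q : ℚ, {p : ℝ × Ω | (clampTime t p.1 q, Y (clampTime t p.1 q) p.2) ∈ K} := by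
    ext ω; simp [stayUntil]
  rw [this]
  refine MeasurableSet.iInter fun q => ?_
  have hjoint : Measurable (Function.uncurry Y) :=
    measurable_uncurry_of_continuous_of_measurable hY hYm
  have hc : Measurable fun p : ℝ × Ω => clampTime t p.1 q := by
    unfold clampTime; fun_prop
  exact (hc.prodMk (hjoint.comp (hc.prodMk measurable_snd))) hK.measurableSet

/-- An adapted process with almost surely continuous paths on `[t,T]` has a version all of whose
paths are continuous, provided the filtration contains the null events. -/
lemma exists_continuous_version {P : Measure Ω} (htT : t ≤ T) (hF : ∀ u ∈ Set.Icc t T, F u ≤ mΩ)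
    (hnull : ∀ u N, MeasurableSet N → P N = 0 → MeasurableSet[F u] N) {X : ℝ → Ω → Space d}
    (hX : ∀ u ∈ Set.Icc t T, Measurable[F u] (X u))
    (hXc : ∀ᵐ ω ∂P, ContinuousOn (fun u => X u ω) (Set.Icc t T)) :
    ∃ Y : ℝ → Ω → Space d, (∀ ω, Continuous fun u => Y u ω) ∧
      (∀ u ∈ Set.Icc t T, Measurable[F u] (Y u)) ∧ (∀ u, Measurable (Y u)) ∧
      ∀ᵐ ω ∂P, ∀ u ∈ Set.Icc t T, Y u ω = X u ω := by
  classical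
  obtain ⟨N, hsub, hN, hPN⟩ := exists_measurable_superset_of_null hXc
  have hmem : ∀ u, clampTime t T u ∈ Set.Icc t T := clampTime_mem htT
  refine ⟨fun u ω => if ω ∈ N then 0 else X (clampTime t T u) ω, fun ω => ?_, fun u hu => ?_,
    fun u => ?_, ?_⟩
  · by_cases hω : ω ∈ N
    · simpa only [if_pos hω] using continuous_const
    · simp only [if_neg hω]
      have hcont : ContinuousOn (fun u => X u ω) (Set.Icc t T) := by
        by_contra hcon
        exact hω (hsub hcon)
      exact hcont.comp_continuous (continuous_clampTime.comp (Continuous.prodMk_right T)) hmem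
  · simp only [clampTime_of_mem hu]
    exact Measurable.ite (hnull u N hN hPN) measurable_const (hX u hu)
  · exact Measurable.ite hN measurable_const ((hX _ (hmem u)).mono (hF _ (hmem u)) le_rfl)
  · have : ∀ᵐ ω ∂P, ω ∉ N := measure_eq_zero_iff_ae_notMem.1 hPN
    filter_upwards [this] with ω hω u hu
    rw [if_neg hω, clampTime_of_mem hu]

end Localization

/-! ### Localized Grönwall argument for the difference of two solutions. -/

section Uniqueness

variable {Ω : Type*} [mΩ : MeasurableSpace Ω] {P : Measure Ω} {F : ℝ → MeasurableSpace Ω}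
  {d d' : ℕ} {t T : ℝ}

/-- Pathwise bound for a localized process `Z = ∫ β du + ∑ⱼ Jⱼ` whose drift satisfies
`‖β‖ ≤ L ‖Z‖`. -/
lemma norm_sq_le_of_localized {s L : ℝ} (hts : t ≤ s) {z β : ℝ → Space d}
    (hz : Continuous z) (hβ : IntegrableOn β (Set.Icc t s))
    (hβz : ∀ u ∈ Set.Icc t s, ‖β u‖ ≤ L * ‖z u‖) {J : Fin d → Fin d' → ℝ}
    (hJ : ∀ i, z s i = (∫ u in t..s, β u) i + ∑ j, J i j) :
    ‖z s‖ ^ 2 ≤ 2 * L ^ 2 * (s - t) * (∫ u in t..s, ‖z u‖ ^ 2) +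
      2 * d' * ∑ i, ∑ j, J i j ^ 2 := by
  have hnorm : ‖∫ u in t..s, β u‖ ^ 2 ≤ L ^ 2 * (s - t) * ∫ u in t..s, ‖z u‖ ^ 2 := by
    have h1 : ‖∫ u in t..s, β u‖ ≤ L * ∫ u in t..s, ‖z u‖ := by
      rw [← intervalIntegral.integral_const_mul]
      refine (intervalIntegral.norm_integral_le_integral_norm hts).trans
        (intervalIntegral.integral_mono_on hts ?_ ?_ hβz)
      · exact ((intervalIntegrable_iff_integrableOn_Icc_of_le hts).2 hβ).norm
      · exact (continuous_const.mul hz.norm).intervalIntegrable _ _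
    have h2 := sq_intervalIntegral_le hts (hz.norm.intervalIntegrable t s)
      ((hz.norm.pow 2).intervalIntegrable t s)
    calc ‖∫ u in t..s, β u‖ ^ 2 ≤ (L * ∫ u in t..s, ‖z u‖) ^ 2 := by gcongr
      _ = L ^ 2 * (∫ u in t..s, ‖z u‖) ^ 2 := by ring
      _ ≤ L ^ 2 * ((s - t) * ∫ u in t..s, ‖z u‖ ^ 2) := by gcongr
      _ = _ := by ring
  rw [EuclideanSpace.real_norm_sq_eq] at hnorm
  rw [EuclideanSpace.real_norm_sq_eq (z s)]
  calc ∑ i, z s i ^ 2 ≤ ∑ i, (2 * (∫ u in t..s, β u) i ^ 2 + 2 * d' * ∑ j, J i j ^ 2) := by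
        refine Finset.sum_le_sum fun i _ => ?_
        have hcs : (∑ j, J i j) ^ 2 ≤ d' * ∑ j, J i j ^ 2 := by
          simpa using sq_sum_le_card_mul_sum_sq (s := Finset.univ) (f := fun j => J i j)
        rw [hJ i]
        nlinarith [sq_nonneg ((∫ u in t..s, β u) i - ∑ j, J i j)]
    _ = 2 * ∑ i, (∫ u in t..s, β u) i ^ 2 + 2 * d' * ∑ i, ∑ j, J i j ^ 2 := by
        rw [Finset.sum_add_distrib, Finset.mul_sum, Finset.mul_sum]
    _ ≤ _ := by linarith

/-- A localized difference of Itô processes with Lipschitz-dominated coefficients vanishes. -/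
lemma ae_eq_zero_of_localized [IsProbabilityMeasure P] {B : Fin d' → ℝ → Ω → ℝ}
    (hB : ∀ j, IsBrownianRelative P F t T (B j)) (hF : ∀ u ∈ Set.Icc t T, F u ≤ mΩ)
    {A : ℝ → Set Ω} (hA : IsLocalization F t T A)
    (hAm : MeasurableSet {p : ℝ × Ω | p.2 ∈ A p.1})
    {Z : ℝ → Ω → Space d} (hZ : ∀ ω, Continuous fun u => Z u ω) (hZm : ∀ u, Measurable (Z u))
    {β : ℝ → Ω → Space d} (hβ : ∀ᵐ ω ∂P, IntegrableOn (fun u => β u ω) (Set.Icc t T))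
    {H H' I I' : Fin d → Fin d' → ℝ → Ω → ℝ}
    (hI : ∀ i j, IsItoIntegral P F t T (B j) (H i j) (I i j))
    (hI' : ∀ i j, IsItoIntegral P F t T (B j) (H' i j) (I' i j))
    (hZI : ∀ᵐ ω ∂P, ∀ s ∈ Set.Icc t T, ∀ i,
      Z s ω i = (∫ u in t..s, β u ω) i + ∑ j, (I i j s ω - I' i j s ω))
    {L R : ℝ} (hL : 0 ≤ L)
    (hlip : ∀ᵐ ω ∂P, ∀ u ∈ Set.Icc t T, ω ∈ A u → ‖β u ω‖ ≤ L * ‖Z u ω‖ ∧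
      ∀ i j, |H i j u ω - H' i j u ω| ≤ L * ‖Z u ω‖)
    (hZR : ∀ u ∈ Set.Icc t T, ∀ ω ∈ A u, ‖Z u ω‖ ≤ R) :
    ∀ s ∈ Set.Ioc t T, ∀ᵐ ω ∂P, ω ∈ A s → Z s ω = 0 := by
  set ψ : ℝ → Ω → ℝ := fun u => (A u).indicator fun ω => ‖Z u ω‖ ^ 2 with hψ
  have hψ0 : ∀ u ω, 0 ≤ ψ u ω := fun u ω => Set.indicator_nonneg (fun _ _ => sq_nonneg _) _
  have hψR : ∀ u ∈ Set.Icc t T, ∀ ω, ψ u ω ≤ R ^ 2 := fun u hu ω => by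
    by_cases hω : ω ∈ A u
    · simp only [hψ, Set.indicator_of_mem hω]
      exact pow_le_pow_left₀ (norm_nonneg _) (hZR u hu ω hω) 2
    · simp only [hψ, Set.indicator_of_notMem hω]
      positivity
  have hψm : Measurable (Function.uncurry ψ) := by
    have h1 : Measurable (Function.uncurry Z) :=
      measurable_uncurry_of_continuous_of_measurable hZ hZm
    exact (h1.norm.pow_const 2).indicator hAm
  set φ : ℝ → ENNReal := fun u => ∫⁻ ω, ENNReal.ofReal (ψ u ω) ∂P with hφ
  have hφR : ∀ s ∈ Set.Ioc t T, φ s ≤ ENNReal.ofReal (R ^ 2) := fun s hs => by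
    calc φ s ≤ ∫⁻ _, ENNReal.ofReal (R ^ 2) ∂P :=
          lintegral_mono fun ω => ENNReal.ofReal_le_ofReal (hψR s ⟨hs.1.le, hs.2⟩ ω)
      _ = _ := by simp
  -- The first term comes from the drift. In the second, `2 * d'` comes from splitting off the drift
  -- and Cauchy–Schwarz over `d'` noises, `d * d'` counts the entries, and `2 * L ^ 2` is the energy
  -- estimate for each.
  set C : ℝ := 2 * L ^ 2 * (T - t) + 2 * d' * (d * (d' * (2 * L ^ 2))) with hC
  have hφC : ∀ s ∈ Set.Ioc t T, φ s ≤ ENNReal.ofReal C * ∫⁻ u in Set.Ioc t s, φ u := by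
    intro s hs
    have hst : 0 ≤ s - t := sub_nonneg.2 hs.1.le
    have hsI : s ∈ Set.Icc t T := ⟨hs.1.le, hs.2⟩
    have hAs := hA.restrict hs.2
    set Q : Ω → ℝ := fun ω => ∫ u in t..s, ψ u ω with hQ
    have hQe : ∀ ω, Q ω = ∫ u in Set.Ioc t s, ψ u ω := fun ω =>
      intervalIntegral.integral_of_le hs.1.le
    have hψi : ∀ ω, IntegrableOn (fun u => ψ u ω) (Set.Ioc t s) := fun ω =>
      Measure.integrableOn_of_bounded (M := R ^ 2) (by simp)
        (hψm.comp measurable_prodMk_right).aestronglyMeasurable (by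
          filter_upwards [ae_restrict_mem measurableSet_Ioc] with u hu
          rw [Real.norm_of_nonneg (hψ0 u ω)]
          exact hψR u ⟨hu.1.le, hu.2.trans hs.2⟩ ω)
    have hQm : Measurable Q := by
      have : Measurable fun ω => ∫ u in Set.Ioc t s, ψ u ω :=
        (StronglyMeasurable.integral_prod_left (f := ψ) hψm.stronglyMeasurable).measurable
      simpa only [← hQe] using this
    have hQ0 : ∀ ω, 0 ≤ Q ω := fun ω =>
      intervalIntegral.integral_nonneg hs.1.le fun u _ => hψ0 u ω
    have hQlint : ∫⁻ ω, ENNReal.ofReal (Q ω) ∂P = ∫⁻ u in Set.Ioc t s, φ u := by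
      calc _ = ∫⁻ ω, (∫⁻ u in Set.Ioc t s, ENNReal.ofReal (ψ u ω)) ∂P := by
            refine lintegral_congr fun ω => ?_
            rw [hQe, ofReal_integral_eq_lintegral_ofReal (hψi ω) (ae_of_all _ fun u => hψ0 u ω)]
        _ = _ := by
            refine lintegral_lintegral_swap ?_
            exact (ENNReal.measurable_ofReal.comp (hψm.comp measurable_swap)).aemeasurable
    have hQi : Integrable Q P := by
      refine Integrable.of_bound hQm.aestronglyMeasurable (R ^ 2 * |s - t|)
        (ae_of_all _ fun ω => ?_)
      refine intervalIntegral.norm_integral_le_of_norm_le_const fun u hu => ?_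
      rw [Set.uIoc_of_le hs.1.le] at hu
      rw [Real.norm_of_nonneg (hψ0 u ω)]
      exact hψR u ⟨hu.1.le, hu.2.trans hs.2⟩ ω
    have hJ : ∀ i j, ∫⁻ ω, ENNReal.ofReal
        ((A s).indicator (fun ω => (I i j s ω - I' i j s ω) ^ 2) ω) ∂P ≤
        ENNReal.ofReal (2 * L ^ 2) * ∫⁻ u in Set.Ioc t s, φ u := by
      intro i j
      have hR0 : 0 ≤ |R| := abs_nonneg R
      refine (lintegral_localized_itoIntegral_sub_sq_le (hB j) hs.1 hs.2 hAs
        (c := L * |R|) (by positivity) (hI i j) (hI' i j) ?_).trans ?_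
      · filter_upwards [hlip] with ω hω u hu hωu
        have huT : u ∈ Set.Icc t T := ⟨hu.1, hu.2.trans hs.2⟩
        refine ((hω u huT hωu).2 i j).trans ?_
        gcongr
        exact (hZR u huT ω hωu).trans (le_abs_self R)
      · rw [← hQlint, ← ofReal_integral_eq_lintegral_ofReal hQi (ae_of_all _ hQ0),
          ← ENNReal.ofReal_mul (by positivity), mul_assoc]
        refine ENNReal.ofReal_le_ofReal (mul_le_mul_of_nonneg_left ?_ zero_le_two)
        rw [← integral_const_mul]
        refine integral_mono_of_nonneg (ae_of_all _ fun ω =>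
          intervalIntegral.integral_nonneg hs.1.le fun u _ =>
            Set.indicator_nonneg (fun _ _ => sq_nonneg _) _) (hQi.const_mul _) ?_
        filter_upwards [hlip, (hI i j).memLp, (hI' i j).memLp] with ω hω m1 m2
        simp only [hQ]
        rw [← intervalIntegral.integral_const_mul]
        refine intervalIntegral.integral_mono_on hs.1.le ?_ ?_ fun u hu => ?_
        · refine hAs.intervalIntegrable_indicator hs.1.le ω
            (g := fun u ω => (H i j u ω - H' i j u ω) ^ 2) ?_
          rw [intervalIntegrable_iff_integrableOn_Icc_of_le hs.1.le]
          have : IntegrableOn (fun u => (H i j u ω - H' i j u ω) ^ 2) (Set.Icc t T) :=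
            (m1.sub m2).integrable_sq
          exact this.mono_set (Set.Icc_subset_Icc_right hs.2)
        · exact ((intervalIntegrable_iff_integrableOn_Ioc_of_le hs.1.le).2 (hψi ω)).const_mul _
        · by_cases hωu : ω ∈ A u
          · simp only [hψ, Set.indicator_of_mem hωu]
            rw [← mul_pow, ← sq_abs]
            exact pow_le_pow_left₀ (abs_nonneg _) ((hω u ⟨hu.1, hu.2.trans hs.2⟩ hωu).2 i j) 2
          · simp only [hψ, Set.indicator_of_notMem hωu, mul_zero, le_refl]
    have hJm : ∀ i j, Measurable fun ω => ENNReal.ofReal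
        ((A s).indicator (fun ω => (I i j s ω - I' i j s ω) ^ 2) ω) := fun i j =>
      ENNReal.measurable_ofReal.comp (Measurable.indicator
        (((((hI i j).adapted s hsI).mono (hF s hsI) le_rfl).sub
          (((hI' i j).adapted s hsI).mono (hF s hsI) le_rfl)).pow_const 2)
        (hF s hsI _ (hA.measurableSet s hsI)))
    calc φ s ≤ ∫⁻ ω, (ENNReal.ofReal (2 * L ^ 2 * (s - t)) * ENNReal.ofReal (Q ω) +
          ENNReal.ofReal (2 * d') * ∑ i, ∑ j, ENNReal.ofReal
            ((A s).indicator (fun ω => (I i j s ω - I' i j s ω) ^ 2) ω)) ∂P := by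
          refine lintegral_mono_ae ?_
          filter_upwards [hZI, hlip, hβ] with ω h1 h2 h3
          by_cases hω : ω ∈ A s
          -- Since `A` decreases, survival up to `s` means survival throughout, so the Lipschitz
          -- bounds hold along the whole path on `[t,s]`.
          · have hmem : ∀ u ∈ Set.Icc t s, ω ∈ A u := fun u hu =>
              hA.anti u s hu.1 hu.2 hs.2 hω
            have hb := norm_sq_le_of_localized hs.1.le (hZ ω)
              (h3.mono_set (Set.Icc_subset_Icc_right hs.2))
              (fun u hu => (h2 u ⟨hu.1, hu.2.trans hs.2⟩ (hmem u hu)).1)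
              (J := fun i j => I i j s ω - I' i j s ω) (h1 s hsI)
            have hQω : Q ω = ∫ u in t..s, ‖Z u ω‖ ^ 2 := by
              refine intervalIntegral.integral_congr fun u hu => ?_
              rw [Set.uIcc_of_le hs.1.le] at hu
              simp only [hψ, Set.indicator_of_mem (hmem u hu)]
            simp only [hψ, Set.indicator_of_mem hω]
            rw [← hQω] at hb
            refine (ENNReal.ofReal_le_ofReal hb).trans (le_of_eq ?_)
            have hs1 : ∀ i, 0 ≤ ∑ j, (I i j s ω - I' i j s ω) ^ 2 := fun i =>
              Finset.sum_nonneg fun _ _ => sq_nonneg _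
            rw [ENNReal.ofReal_add (mul_nonneg (by positivity) (hQ0 ω))
              (mul_nonneg (by positivity) (Finset.sum_nonneg fun i _ => hs1 i)),
              ENNReal.ofReal_mul (p := 2 * L ^ 2 * (s - t)) (by positivity),
              ENNReal.ofReal_mul (p := 2 * (d' : ℝ)) (by positivity),
              ENNReal.ofReal_sum_of_nonneg fun i _ => hs1 i]
            simp only [ENNReal.ofReal_sum_of_nonneg fun j _ => sq_nonneg _]
          · simp [hψ, Set.indicator_of_notMem hω]
      _ = ENNReal.ofReal (2 * L ^ 2 * (s - t)) * (∫⁻ u in Set.Ioc t s, φ u) +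
          ENNReal.ofReal (2 * d') * ∑ i, ∑ j, ∫⁻ ω, ENNReal.ofReal
            ((A s).indicator (fun ω => (I i j s ω - I' i j s ω) ^ 2) ω) ∂P := by
          have hQm' : Measurable fun ω => ENNReal.ofReal (Q ω) :=
            ENNReal.measurable_ofReal.comp hQm
          rw [lintegral_add_left (hQm'.const_mul _), lintegral_const_mul _ hQm', hQlint,
            lintegral_const_mul _ (Finset.measurable_fun_sum _ fun i _ =>
              Finset.measurable_fun_sum _ fun j _ => hJm i j),
            lintegral_finsetSum _ fun i _ => Finset.measurable_fun_sum _ fun j _ => hJm i j]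
          simp only [lintegral_finsetSum _ fun j _ => hJm _ j]
      _ ≤ ENNReal.ofReal (2 * L ^ 2 * (T - t)) * (∫⁻ u in Set.Ioc t s, φ u) +
          ENNReal.ofReal (2 * d') * ∑ _i : Fin d, ∑ _j : Fin d',
            ENNReal.ofReal (2 * L ^ 2) * ∫⁻ u in Set.Ioc t s, φ u := by
          gcongr with i _ j _
          · exact hs.2
          · exact hJ i j
      _ = ENNReal.ofReal C * ∫⁻ u in Set.Ioc t s, φ u := by
          have hTt : 0 ≤ T - t := hst.trans (by linarith [hs.2])
          rw [hC, ENNReal.ofReal_add (by positivity) (by positivity), add_mul]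
          congr 1
          simp only [Finset.sum_const, Finset.card_univ, Fintype.card_fin, nsmul_eq_mul]
          rw [ENNReal.ofReal_mul (p := 2 * (d' : ℝ)) (by positivity),
            ENNReal.ofReal_mul (p := (d : ℝ)) (by positivity),
            ENNReal.ofReal_mul (p := (d' : ℝ)) (by positivity), ENNReal.ofReal_natCast,
            ENNReal.ofReal_natCast]
          ring
  intro s hs
  have hC0 : 0 ≤ C := by
    have : 0 ≤ T - t := by linarith [hs.1, hs.2]
    positivity
  have hzero := eq_zero_of_le_lintegral hC0 (sq_nonneg R) hφR hφC s hs
  have hψsm : Measurable fun ω => ENNReal.ofReal (ψ s ω) :=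
    ENNReal.measurable_ofReal.comp (hψm.comp measurable_prodMk_left)
  rw [hφ, lintegral_eq_zero_iff hψsm] at hzero
  filter_upwards [hzero] with ω hω hωs
  have : ‖Z s ω‖ ^ 2 ≤ 0 := by
    simpa [hψ, Set.indicator_of_mem hωs] using hω
  exact norm_eq_zero.1 (pow_eq_zero_iff two_ne_zero |>.1 (le_antisymm this (sq_nonneg _)))

lemma IsItoIntegral.ae_eq_zero_left {B H I : ℝ → Ω → ℝ} (hI : IsItoIntegral P F t T B H I)
    (htT : t ≤ T) : ∀ᵐ ω ∂P, I t ω = 0 := by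
  obtain ⟨G, -, hG⟩ := hI.approx
  obtain ⟨n, -, hn⟩ := (hG t ⟨le_rfl, htT⟩).exists_seq_tendsto_ae
  filter_upwards [hn] with ω hω
  refine tendsto_nhds_unique hω (tendsto_const_nhds.congr fun k => ?_)
  simp [ElementaryProcess.integral, min_eq_right ((G (n k)).time_mem _).1]

/-- This settles the degenerate case `t = T`, where the open interval used for the density argument
is empty. -/
lemma IsStrongSolution.ae_eq_start {W : ℝ → Ω → Fin d' → ℝ} {μ : ℝ × Space d → Space d}
    {σ : ℝ × Space d → Matrix (Fin d) (Fin d') ℝ} {α : ℝ × Space d → Space d'} {x : Space d}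
    {X : ℝ → Ω → Space d} (hX : IsStrongSolution P W T μ σ α t x X) (htT : t ≤ T) :
    ∀ᵐ ω ∂P, X t ω = x := by
  obtain ⟨I, hI, heq⟩ := hX.equation
  have h0 : ∀ᵐ ω ∂P, ∀ i j, I i j t ω = 0 :=
    ae_all_iff.2 fun i => ae_all_iff.2 fun j => (hI i j).ae_eq_zero_left htT
  filter_upwards [h0, heq] with ω h1 h2
  ext i
  rw [h2 t ⟨le_rfl, htT⟩ i]
  simp [h1]

end Uniqueness

end ConstrainedSDE

end

/-! ### Exhaustion by inner regions and conclusion. -/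

open ConstrainedSDE in
theorem proposition3p3 {d d' : ℕ} {Ω : Type*} [MeasurableSpace Ω] (P : Measure Ω)
    [IsProbabilityMeasure P] (T : ℝ) (W : ℝ → Ω → Fin d' → ℝ) (hW : IsBrownianMotionOn T W P)
    (μ : ℝ × Space d → Space d) (σ : ℝ × Space d → Matrix (Fin d) (Fin d') ℝ)
    (hμσ : IsCoefficientPair T μ σ)
    (D : Set (ℝ × Space d)) (hD_subset : D ⊆ timeSpace d T) (hD_closed : IsClosed D)
    (α : ℝ × Space d → Space d')
    (hα_meas : Measurable ((allowedBefore T D).domRestrict α))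
    (hα_lip : LocallyLipschitzInSpaceOn α (allowedBefore T D))
    (hα_bdd : LocallyBoundedOn α (allowedBefore T D))
    (t : ℝ) (x : Space d) (htx : (t, x) ∈ allowed T D)
    (X X' : ℝ → Ω → Space d)
    (hX : IsStrongSolution P W T μ σ α t x X) (hXC : StaysIn P T (allowed T D) t X)
    (hX' : IsStrongSolution P W T μ σ α t x X') (hXC' : StaysIn P T (allowed T D) t X') :
    ∀ᵐ ω ∂P, ∀ s ∈ Set.Icc t T, X s ω = X' s ω := by
  have ht0 : 0 ≤ t := htx.1.1
  have htT : t ≤ T := htx.1.2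
  rcases htT.eq_or_lt with rfl | hlt
  · filter_upwards [hX.ae_eq_start le_rfl, hX'.ae_eq_start le_rfl] with ω h1 h2 s hs
    rw [le_antisymm hs.2 hs.1, h1, h2]
  have hB := isBrownianRelative hW ht0
  have hF : ∀ u ∈ Set.Icc t T, brownianFiltration P W u ≤ ‹MeasurableSpace Ω› := fun u hu =>
    brownianFiltration_le hW hu.2
  have hFmono : ∀ r u, t ≤ r → r ≤ u → u ≤ T →
      brownianFiltration P W r ≤ brownianFiltration P W u := fun _ _ _ h _ =>
    brownianFiltration_mono h
  obtain ⟨Y, hYc, hYF, hYm, hYX⟩ := exists_continuous_version htT hF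
    (fun _ _ => measurableSet_brownianFiltration_of_null) hX.adapted hX.continuous
  obtain ⟨Y', hYc', hYF', hYm', hYX'⟩ := exists_continuous_version htT hF
    (fun _ _ => measurableSet_brownianFiltration_of_null) hX'.adapted hX'.continuous
  obtain ⟨I, hI, heq⟩ := hX.equation
  obtain ⟨I', hI', heq'⟩ := hX'.equation
  have hloc : ∀ n : ℕ, ∀ s ∈ Set.Ioc t T, ∀ᵐ ω ∂P,
      ω ∈ stayUntil (innerRegion T D n) t Y s ∩ stayUntil (innerRegion T D n) t Y' s →
        Y s ω - Y' s ω = 0 := by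
    intro n
    obtain ⟨L, hL, hlip⟩ := exists_lipschitz_innerRegion hμσ hα_lip hα_bdd n
    have hK : IsClosed (innerRegion T D n) := (isCompact_innerRegion n).isClosed
    have hmem : ∀ u ∈ Set.Icc t T, ∀ ω ∈ stayUntil (innerRegion T D n) t Y u ∩
        stayUntil (innerRegion T D n) t Y' u,
        (u, Y u ω) ∈ innerRegion T D n ∧ (u, Y' u ω) ∈ innerRegion T D n := fun u hu ω hω =>
      ⟨(mem_stayUntil_iff hK (hYc ω) hu.1).1 hω.1 u ⟨hu.1, le_rfl⟩,
        (mem_stayUntil_iff hK (hYc' ω) hu.1).1 hω.2 u ⟨hu.1, le_rfl⟩⟩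
    refine ae_eq_zero_of_localized (F := brownianFiltration P W) hB hF
      (A := fun u => stayUntil (innerRegion T D n) t Y u ∩ stayUntil (innerRegion T D n) t Y' u)
      ((isLocalization_stayUntil hK hYc hFmono hYF).inter
        (isLocalization_stayUntil hK hYc' hFmono hYF'))
      ((measurableSet_prod_stayUntil hK hYc hYm).inter
        (measurableSet_prod_stayUntil hK hYc' hYm'))
      (Z := fun u ω => Y u ω - Y' u ω) (fun ω => (hYc ω).sub (hYc' ω))
      (fun u => (hYm u).sub (hYm' u))
      (β := fun u ω => controlledDrift μ σ α (u, X u ω) - controlledDrift μ σ α (u, X' u ω))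
      ?_ hI hI' ?_ (R := 2 * n) hL ?_ ?_
    · filter_upwards [hX.integrable_drift, hX'.integrable_drift] with ω h1 h2 using h1.sub h2
    · filter_upwards [hX.integrable_drift, hX'.integrable_drift, heq, heq', hYX, hYX'] with
        ω h1 h2 e1 e2 v1 v2 s hs i
      have hii : ∀ {f : ℝ → Space d}, IntegrableOn f (Set.Icc t T) →
          IntervalIntegrable f volume t s := fun hf =>
        (intervalIntegrable_iff_integrableOn_Icc_of_le hs.1).2
          (hf.mono_set (Set.Icc_subset_Icc_right hs.2))
      rw [v1 s hs, v2 s hs, intervalIntegral.integral_sub (hii h1) (hii h2), PiLp.sub_apply,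
        PiLp.sub_apply, e1 s hs i, e2 s hs i, Finset.sum_sub_distrib]
      ring
    · filter_upwards [hYX, hYX'] with ω v1 v2 u hu hω
      obtain ⟨m1, m2⟩ := hmem u hu ω hω
      have := hlip u _ _ m1 m2
      rw [← v1 u hu, ← v2 u hu]
      exact this
    · intro u hu ω hω
      obtain ⟨m1, m2⟩ := hmem u hu ω hω
      have h1 : ‖Y u ω‖ ≤ n := (norm_snd_le (u, Y u ω)).trans m1.2.2.1
      have h2 : ‖Y' u ω‖ ≤ n := (norm_snd_le (u, Y' u ω)).trans m2.2.2.1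
      exact (norm_sub_le _ _).trans (by linarith)
  -- The exceptional null set in `hloc` depends on the time and on `n`; restricting to rational
  -- times leaves a countable union.
  have hrat : ∀ᵐ ω ∂P, ∀ (n : ℕ) (q : ℚ), (q : ℝ) ∈ Set.Ioc t T →
      ω ∈ stayUntil (innerRegion T D n) t Y q ∩ stayUntil (innerRegion T D n) t Y' q →
        Y q ω - Y' q ω = 0 := by
    refine ae_all_iff.2 fun n => ae_all_iff.2 fun q => ?_
    by_cases hq : (q : ℝ) ∈ Set.Ioc t T
    · filter_upwards [hloc n q hq] with ω hω _ using hω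
    · exact ae_of_all _ fun ω h => absurd h hq
  filter_upwards [hrat, hYX, hYX', hXC, hXC'] with ω h v1 v2 c1 c2
  -- The restriction `q < T` keeps the compact path inside `𝒞_{[0,T)}`, where the bounds on `α`
  -- hold.
  have hpath : ∀ {V : ℝ → Ω → Space d}, Continuous (fun u => V u ω) →
      (∀ u ∈ Set.Icc t T, (u, V u ω) ∈ allowed T D) → ∀ q < T,
        IsCompact ((fun u => (u, V u ω)) '' Set.Icc t q) ∧
        (fun u => (u, V u ω)) '' Set.Icc t q ⊆ allowedBefore T D := by
    intro V hV hVC q hq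
    refine ⟨isCompact_Icc.image (continuous_id.prodMk hV), ?_⟩
    rintro _ ⟨u, hu, rfl⟩
    exact ⟨hVC u ⟨hu.1, hu.2.trans hq.le⟩, hu.2.trans_lt hq⟩
  have hzero : Set.Ioo t T ∩ Set.range ((↑) : ℚ → ℝ) ⊆ {u | Y u ω = Y' u ω} := by
    rintro _ ⟨hq, q, rfl⟩
    obtain ⟨k1, s1⟩ := hpath (hYc ω) (fun u hu => by rw [v1 u hu]; exact c1 u hu) q hq.2
    obtain ⟨k2, s2⟩ := hpath (hYc' ω) (fun u hu => by rw [v2 u hu]; exact c2 u hu) q hq.2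
    obtain ⟨n, hn⟩ := exists_subset_innerRegion hD_closed (k1.union k2) (Set.union_subset s1 s2)
    have hK : IsClosed (innerRegion T D n) := (isCompact_innerRegion n).isClosed
    refine sub_eq_zero.1 (h n q ⟨hq.1, hq.2.le⟩ ⟨?_, ?_⟩)
    · rw [mem_stayUntil_iff hK (hYc ω) hq.1.le]
      exact fun r hr => hn (Or.inl ⟨r, hr, rfl⟩)
    · rw [mem_stayUntil_iff hK (hYc' ω) hq.1.le]
      exact fun r hr => hn (Or.inr ⟨r, hr, rfl⟩)
  have hcl : IsClosed {u | Y u ω = Y' u ω} := isClosed_eq (hYc ω) (hYc' ω)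
  have hIoo : Set.Ioo t T ⊆ {u | Y u ω = Y' u ω} :=
    (Rat.denseRange_cast.open_subset_closure_inter isOpen_Ioo).trans (closure_minimal hzero hcl)
  intro s hs
  have hs' : s ∈ closure (Set.Ioo t T) := by rwa [closure_Ioo hlt.ne]
  have := closure_minimal hIoo hcl hs'
  rw [← v1 s hs, ← v2 s hs]
  exact this
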